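/- Let $x(u), y(u)$ be the expansions at $u=0$ of the coordinates of a point $(x,y)$ near the point $\infty$ of the curve $y^2=x^5-1$, as functions of $u=\int_\infty^{(x,y)}\frac{x\,dx}{2y}$; equivalently, $(x(u),y(u))$ is the unique pair of formal Laurent series in $u$ with rational coefficients such that $y^2=x^5-1$, $x\,\frac{dx}{du}=2y$, and $x(u)$ has a pole at $u=0$. Define rational numbers $C_{10n}$, $D_{10n}$ $(n\ge 1)$ by $$x(u)=\frac1{u^2}+\sum_{n=1}^\infty\frac{C_{10n}}{10n}\,\frac{u^{10n-2}}{(10n-2)!},\qquad y(u)=\frac{-1}{u^5}+\sum_{n=1}^\infty\frac{D_{10n}}{10n}\,\frac{u^{10n-5}}{(10n-5)!}.$$ Let $p\equiv 1 \pmod 5$ be a prime, put $A_p=(-1)^{(p-1)/10}\binom{(p-1)/2}{(p-1)/10}$, and let $a,n$ be positive integers with $10n-2\ge a$ and $(p-1)\nmid 10n$. Then $$\sum_{r=0}^a(-1)^r\binom ar A_p^{\,a-r}\,\frac{C_{10n+r(p-1)}}{10n+r(p-1)}\equiv 0 \pmod{p^a},$$ and, if moreover $a\ne 10n-2$ (that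 is, $10n-3\ge a$), $$\sum_{r=0}^a(-1)^r\binom ar A_p^{\,a-r}\,\frac{D_{10n+r(p-1)}}{10n+r(p-1)}\equiv 0 \pmod{p^a}.$$ Here $q\equiv 0\pmod{p^a}$ for a rational number $q$ means $q\in p^a\mathbb Z_{(p)}$. -/

import Mathlib

noncomputable section

namespace CurveInversion

open PowerSeries (X)

/-! ### Inversion of the integral `u = ∫_∞ x dx / (2y)` on the curve `y² = x⁵ - 1`

The pair of Laurent series below is the pair of expansions at `u = 0` of the coordinates `x`, `y` of
a point of the curve near infinity, as functions of `u = ∫_∞^{(x,y)} x dx / (2y)`. -/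

/-- `x` and `y` are formal Laurent series in `u` with `y² = x⁵ - 1` and `x · dx/du = 2y` (that is
`du = x dx / (2y)`), and `u = 0` corresponds to the point at infinity, i.e. `x` has a pole there.
Such a pair exists and is unique, see `existsUnique_isInversion`. -/
structure IsInversion (x y : LaurentSeries ℚ) : Prop where
  pole : x.order < 0
  curve : y ^ 2 = x ^ 5 - 1
  differential : x * LaurentSeries.derivative ℚ x = 2 * y

instance charZeroLaurentSeries : CharZero (LaurentSeries ℚ) := algebraRat.charZero _

instance charZeroPowerSeries : CharZero (PowerSeries ℚ) := algebraRat.charZero _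

/-! Existence and uniqueness, through `w = 1/x`, which satisfies `w'' = 2 - 12 w⁵`. -/

lemma derivative_coeff (f : LaurentSeries ℚ) (n : ℤ) :
    (LaurentSeries.derivative ℚ f).coeff n = (n + 1) * f.coeff (n + 1) := by
  simp [LaurentSeries.derivative_apply, LaurentSeries.hasseDeriv_coeff]

lemma derivative_mul (f g : LaurentSeries ℚ) :
    LaurentSeries.derivative ℚ (f * g) =
      LaurentSeries.derivative ℚ f * g + f * LaurentSeries.derivative ℚ g := by
  -- the Euler operator `u d/du`
  have key : ∀ h : LaurentSeries ℚ, ∀ n : ℤ,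
      (HahnSeries.single (1 : ℤ) (1 : ℚ) * LaurentSeries.derivative ℚ h).coeff n
        = n * h.coeff n := by
    intro h n
    rw [HahnSeries.coeff_single_mul, derivative_coeff]
    simp
  have hne : HahnSeries.single (1 : ℤ) (1 : ℚ) ≠ 0 := by simp
  apply mul_left_cancel₀ hne
  have e : HahnSeries.single (1 : ℤ) (1 : ℚ) *
      (LaurentSeries.derivative ℚ f * g + f * LaurentSeries.derivative ℚ g) =
      (HahnSeries.single (1 : ℤ) (1 : ℚ) * LaurentSeries.derivative ℚ f) * g +
      f * (HahnSeries.single (1 : ℤ) (1 : ℚ) * LaurentSeries.derivative ℚ g) := by ring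
  rw [e]
  ext n
  rw [key, HahnSeries.coeff_add, HahnSeries.coeff_mul,
    HahnSeries.coeff_mul_left' (hs := f.isPWO_support),
    HahnSeries.coeff_mul_right' (hs := g.isPWO_support), Finset.mul_sum, ← Finset.sum_add_distrib]
  · apply Finset.sum_congr rfl
    rintro ⟨i, j⟩ hij
    rw [Finset.mem_antidiagonal] at hij
    rw [key, key, ← hij.2.2]
    push_cast
    ring
  · intro m hm
    rw [HahnSeries.mem_support, key] at hm
    exact HahnSeries.mem_support _ _ |>.2 (right_ne_zero_of_mul hm)
  · intro m hm
    rw [HahnSeries.mem_support, key] at hm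
    exact HahnSeries.mem_support _ _ |>.2 (right_ne_zero_of_mul hm)

lemma derivative_coe (f : PowerSeries ℚ) :
    LaurentSeries.derivative ℚ (f : LaurentSeries ℚ) =
      ((PowerSeries.derivative (R := ℚ) f : PowerSeries ℚ) : LaurentSeries ℚ) := by
  ext n
  rw [derivative_coeff]
  rcases lt_trichotomy n (-1) with h | h | h
  · rw [PowerSeries.coeff_coe, PowerSeries.coeff_coe, if_pos (by omega), if_pos (by omega)]
    simp
  · subst h
    rw [PowerSeries.coeff_coe, PowerSeries.coeff_coe]
    simp
  · obtain ⟨m, rfl⟩ := Int.eq_ofNat_of_zero_le (show 0 ≤ n by omega)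
    have := LaurentSeries.coeff_coe_powerSeries f (m + 1)
    push_cast at this
    rw [this, LaurentSeries.coeff_coe_powerSeries, PowerSeries.coeff_derivative]
    push_cast
    ring

lemma derivative_inv {f : LaurentSeries ℚ} (hf : f ≠ 0) :
    LaurentSeries.derivative ℚ f⁻¹ = -(f⁻¹ ^ 2 * LaurentSeries.derivative ℚ f) := by
  have h1 : LaurentSeries.derivative ℚ (1 : LaurentSeries ℚ) = 0 := by
    ext n
    rw [derivative_coeff, HahnSeries.coeff_one]
    split_ifs with h
    · have : (n : ℚ) + 1 = 0 := by exact_mod_cast h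
      simp [this]
    · simp
  have h2 := derivative_mul f f⁻¹
  rw [mul_inv_cancel₀ hf, h1] at h2
  have h3 : f⁻¹ * (LaurentSeries.derivative ℚ f * f⁻¹ + f * LaurentSeries.derivative ℚ f⁻¹) = 0 := by
    rw [← h2, mul_zero]
  rw [mul_add, ← mul_assoc _ f, inv_mul_cancel₀ hf] at h3
  linear_combination h3

/-- Coefficients of the power series `w` with `w'' = 2 - 12 w⁵`, `w(0) = w'(0) = 0`. -/
def wCoeff : ℕ → ℚ
  | 0 => 0
  | 1 => 0
  | n + 2 => PowerSeries.coeff n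
      (2 - 12 * (PowerSeries.mk fun m => if _h : m ≤ n then wCoeff m else 0) ^ 5)
        / ((n + 2) * (n + 1))
  decreasing_by omega

lemma coeff_congr {f g : PowerSeries ℚ} {n : ℕ}
    (h : ∀ m ≤ n, PowerSeries.coeff m f = PowerSeries.coeff m g) :
    PowerSeries.coeff n (2 - 12 * f ^ 5) = PowerSeries.coeff n (2 - 12 * g ^ 5) := by
  have h1 : (X : PowerSeries ℚ) ^ (n + 1) ∣ g - f := by
    rw [PowerSeries.X_pow_dvd_iff]
    intro m hm
    rw [map_sub, h m (by omega), sub_self]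
  have h2 : (X : PowerSeries ℚ) ^ (n + 1) ∣ (2 - 12 * f ^ 5) - (2 - 12 * g ^ 5) := by
    have h3 := (h1.trans (sub_dvd_pow_sub_pow g f 5)).mul_left 12
    convert h3 using 1
    ring
  have h4 := PowerSeries.X_pow_dvd_iff.1 h2 n (by omega)
  rw [map_sub] at h4
  linarith

lemma exists_ode : ∃ w : PowerSeries ℚ, PowerSeries.coeff 0 w = 0 ∧ PowerSeries.coeff 1 w = 0 ∧
    PowerSeries.derivative (R := ℚ) (PowerSeries.derivative (R := ℚ) w) = 2 - 12 * w ^ 5 := by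
  refine ⟨PowerSeries.mk wCoeff, by simp [wCoeff], by simp [wCoeff], ?_⟩
  ext n
  rw [PowerSeries.coeff_derivative, PowerSeries.coeff_derivative, PowerSeries.coeff_mk, wCoeff,
    coeff_congr (g := PowerSeries.mk wCoeff)]
  · have h1 : (n : ℚ) + 1 ≠ 0 := by positivity
    have h2 : (n : ℚ) + 2 ≠ 0 := by positivity
    push_cast
    field_simp
    ring
  · intro m hm
    simp [hm]

lemma ode_unique {v w : PowerSeries ℚ}
    (hv0 : PowerSeries.coeff 0 v = 0) (hv1 : PowerSeries.coeff 1 v = 0)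
    (hv : PowerSeries.derivative (R := ℚ) (PowerSeries.derivative (R := ℚ) v) = 2 - 12 * v ^ 5)
    (hw0 : PowerSeries.coeff 0 w = 0) (hw1 : PowerSeries.coeff 1 w = 0)
    (hw : PowerSeries.derivative (R := ℚ) (PowerSeries.derivative (R := ℚ) w) = 2 - 12 * w ^ 5) :
    v = w := by
  ext n
  induction n using Nat.strong_induction_on with
  | _ n ih =>
    match n, ih with
    | 0, _ => rw [hv0, hw0]
    | 1, _ => rw [hv1, hw1]
    | n + 2, ih =>
      have h := coeff_congr (f := v) (g := w) (n := n) (fun m hm => ih m (by omega))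
      rw [← hv, ← hw, PowerSeries.coeff_derivative, PowerSeries.coeff_derivative,
        PowerSeries.coeff_derivative, PowerSeries.coeff_derivative] at h
      have h1 : (n : ℚ) + 1 ≠ 0 := by positivity
      have h2 : ((n + 1 : ℕ) : ℚ) + 1 ≠ 0 := by positivity
      exact mul_right_cancel₀ h2 (mul_right_cancel₀ h1 h)

lemma exists_isInversion : ∃ x y : LaurentSeries ℚ, IsInversion x y := by
  obtain ⟨w, h0, h1, h⟩ := exists_ode
  -- the first integral of the differential equation
  have hsq : PowerSeries.derivative (R := ℚ) w ^ 2 = 4 * (w - w ^ 6) := by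
    apply PowerSeries.derivative.ext
    · rw [PowerSeries.derivative_pow, h]
      simp only [Derivation.leibniz, map_sub, PowerSeries.derivative_pow]
      have h4 : PowerSeries.derivative (R := ℚ) (4 : PowerSeries ℚ) = 0 := by
        exact_mod_cast (PowerSeries.derivative (R := ℚ)).map_natCast 4
      rw [h4]
      simp only [smul_eq_mul]
      push_cast
      ring
    · have e0 : PowerSeries.constantCoeff w = 0 := by simpa using h0
      have e1 : PowerSeries.constantCoeff (PowerSeries.derivative (R := ℚ) w) = 0 := by
        rw [← PowerSeries.coeff_zero_eq_constantCoeff_apply, PowerSeries.coeff_derivative]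
        simp [h1]
      simp [e0, e1]
  have hw : w ≠ 0 := by
    rintro rfl
    rw [map_zero, map_zero] at h
    have h2 : (2 : PowerSeries ℚ) = 0 := by linear_combination -h
    exact two_ne_zero h2
  set W : LaurentSeries ℚ := (w : LaurentSeries ℚ) with hW
  have hW0 : W ≠ 0 := by
    rw [hW]
    exact (map_ne_zero_iff _ HahnSeries.ofPowerSeries_injective).2 hw
  have hWsq : LaurentSeries.derivative ℚ W ^ 2 = 4 * (W - W ^ 6) := by
    rw [hW, derivative_coe, ← map_pow, hsq, map_mul, map_sub, map_pow, map_ofNat]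
  have hWord : 0 < W.order := by
    by_contra hc
    have hlead : W.coeff W.order ≠ 0 := mt HahnSeries.coeff_order_eq_zero.1 hW0
    apply hlead
    generalize W.order = k at hc
    rw [hW, PowerSeries.coeff_coe]
    split_ifs with hk
    · rfl
    · have : k = 0 := by omega
      subst this
      simpa using h0
  have hy : ∀ z : LaurentSeries ℚ, 2 * (z / 2) = z := fun z => by
    have : (2 : LaurentSeries ℚ) ≠ 0 := two_ne_zero
    field_simp
  refine ⟨W⁻¹, W⁻¹ * LaurentSeries.derivative ℚ W⁻¹ / 2, ?_, ?_, (hy _).symm⟩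
  · have hm := HahnSeries.order_mul hW0 (inv_ne_zero hW0)
    rw [mul_inv_cancel₀ hW0, HahnSeries.order_one] at hm
    omega
  · rw [derivative_inv hW0]
    have : (W⁻¹ * -(W⁻¹ ^ 2 * LaurentSeries.derivative ℚ W) / 2) ^ 2 =
        W⁻¹ ^ 6 * LaurentSeries.derivative ℚ W ^ 2 / 4 := by
      field_simp
      ring
    rw [this, hWsq]
    have h4 : (4 : LaurentSeries ℚ) ≠ 0 := by norm_num
    field_simp

/-- `1/x` is the solution of the regular differential equation. -/
lemma IsInversion.inv_eq {x y : LaurentSeries ℚ} (h : IsInversion x y) :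
    ∃ w : PowerSeries ℚ, x⁻¹ = (w : LaurentSeries ℚ) ∧
      PowerSeries.coeff 0 w = 0 ∧ PowerSeries.coeff 1 w = 0 ∧
      PowerSeries.derivative (R := ℚ) (PowerSeries.derivative (R := ℚ) w) = 2 - 12 * w ^ 5 := by
  have hx : x ≠ 0 := by
    rintro rfl
    simpa using h.pole
  have hord : 0 < (x⁻¹).order := by
    have hm := HahnSeries.order_mul hx (inv_ne_zero hx)
    rw [mul_inv_cancel₀ hx, HahnSeries.order_one] at hm
    have := h.pole
    omega
  obtain ⟨k, hk⟩ := Int.eq_ofNat_of_zero_le hord.le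
  have hk0 : k ≠ 0 := by
    rintro rfl
    rw [hk] at hord
    simp at hord
  obtain ⟨w, hw⟩ : ∃ w : PowerSeries ℚ, x⁻¹ = (w : LaurentSeries ℚ) :=
    ⟨_, (LaurentSeries.X_order_mul_powerSeriesPart hk.symm).symm⟩
  have h0 : PowerSeries.coeff 0 w = 0 := by
    rw [← LaurentSeries.coeff_coe_powerSeries, ← hw]
    exact HahnSeries.coeff_eq_zero_of_lt_order (by exact_mod_cast hord)
  have hw0 : w ≠ 0 := by
    rintro rfl
    rw [map_zero] at hw
    exact inv_ne_zero hx hw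
  have hsqL : LaurentSeries.derivative ℚ x⁻¹ ^ 2 = 4 * (x⁻¹ - x⁻¹ ^ 6) := by
    rw [derivative_inv hx]
    have e : (-(x⁻¹ ^ 2 * LaurentSeries.derivative ℚ x)) ^ 2 =
        x⁻¹ ^ 6 * (x * LaurentSeries.derivative ℚ x) ^ 2 := by
      field_simp
    rw [e, h.differential, mul_pow, h.curve]
    field_simp
    ring
  have hsq : PowerSeries.derivative (R := ℚ) w ^ 2 = 4 * (w - w ^ 6) := by
    rw [hw, derivative_coe] at hsqL
    apply HahnSeries.ofPowerSeries_injective (Γ := ℤ)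
    rw [map_pow, hsqL, map_mul, map_sub, map_pow, map_ofNat]
  have h1 : PowerSeries.coeff 1 w = 0 := by
    have e0 : PowerSeries.constantCoeff w = 0 := by simpa using h0
    have := congrArg PowerSeries.constantCoeff hsq
    simp only [map_pow, map_mul, map_sub, e0] at this
    rw [← PowerSeries.coeff_zero_eq_constantCoeff_apply, PowerSeries.coeff_derivative] at this
    simpa using this
  refine ⟨w, hw, h0, h1, ?_⟩
  have hd : PowerSeries.derivative (R := ℚ) w ≠ 0 := by
    intro hd
    apply hw0
    apply PowerSeries.derivative.ext
    · rw [hd, map_zero]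
    · simpa using h0
  have h4 : PowerSeries.derivative (R := ℚ) (4 : PowerSeries ℚ) = 0 := by
    exact_mod_cast (PowerSeries.derivative (R := ℚ)).map_natCast 4
  have h2 := congrArg (PowerSeries.derivative (R := ℚ)) hsq
  simp only [Derivation.leibniz, map_sub, PowerSeries.derivative_pow, h4, smul_eq_mul] at h2
  have h2' : (2 * PowerSeries.derivative (R := ℚ) w) ≠ 0 := mul_ne_zero two_ne_zero hd
  apply mul_left_cancel₀ h2'
  push_cast at h2
  linear_combination h2

theorem existsUnique_isInversion :
    ∃! q : LaurentSeries ℚ × LaurentSeries ℚ, IsInversion q.1 q.2 := by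
  obtain ⟨x, y, h⟩ := exists_isInversion
  refine ⟨(x, y), h, ?_⟩
  rintro ⟨x', y'⟩ h'
  obtain ⟨w, e, h0, h1, h2⟩ := h.inv_eq
  obtain ⟨w', e', h0', h1', h2'⟩ := IsInversion.inv_eq h'
  have hxx : x' = x := by
    rw [← inv_inv x', ← inv_inv x, e, ← ode_unique h0' h1' h2' h0 h1 h2, ← e']
  have hyy : y' = y := by
    have a := h.differential
    have b := IsInversion.differential h'
    simp only [hxx] at b
    rw [a] at b
    exact (mul_left_cancel₀ two_ne_zero b).symm
  rw [hxx, hyy]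

/-- The expansion of the coordinate `x` in powers of `u`; it begins with `1/u²`. -/
def xSeries : LaurentSeries ℚ := existsUnique_isInversion.choose.1

/-- The expansion of the coordinate `y` in powers of `u`; it begins with `-1/u⁵`. -/
def ySeries : LaurentSeries ℚ := existsUnique_isInversion.choose.2

theorem isInversion_series : IsInversion xSeries ySeries :=
  existsUnique_isInversion.choose_spec.1

/-- `x = 1/u² + ∑ (C_m / m) u^(m-2) / (m-2)!`, the sum being over the positive multiples `m` of
`10`; only the values at these `m` are used. -/
def genC (m : ℕ) : ℚ := m * ((m - 2).factorial * xSeries.coeff ((m : ℤ) - 2))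

/-- `y = -1/u⁵ + ∑ (D_m / m) u^(m-5) / (m-5)!`, the sum being over the positive multiples `m` of
`10`; only the values at these `m` are used. -/
def genD (m : ℕ) : ℚ := m * ((m - 5).factorial * ySeries.coeff ((m : ℤ) - 5))

/-- `A_p = (-1)^((p-1)/10) binom((p-1)/2, (p-1)/10)`, for a prime `p ≡ 1 mod 5` (so that `10`
divides `p - 1`). -/
def hasseA (p : ℕ) : ℤ := (-1) ^ ((p - 1) / 10) * (((p - 1) / 2).choose ((p - 1) / 10) : ℤ)

/-- `q ≡ 0 mod p^a` for a rational number `q`: it is `p^a` times a rational number whose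
denominator is prime to `p`, that is, `q` lies in `p^a ℤ_(p)`. -/
def CongrZero (p a : ℕ) (q : ℚ) : Prop := ∃ z : ℚ, ¬ p ∣ z.den ∧ q = (p : ℚ) ^ a * z

end CurveInversion

end

noncomputable section

namespace CurveExpansion

open PowerSeries

/-! ### Derivations in characteristic `p`. -/

section IteratedDerivation

variable {R A : Type*} [CommRing R] [CommRing A] [Algebra R A]

/-! Put t = x^(-1/2). Then u = ∫ (1 - t^10)^(-1/2) dt has coefficients b_k / (10k+1) with b_k =
binom(2k,k) / 4^k. Write p = 10q + 1. Dwork-type congruences give a p-adic integer α ≡ A_p mod p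
with b_{kp+q} ≡ α b_k modulo p(10k+1) (`exists_unitRoot`). By the functional equation lemma
(`integral_of_subst_eq`), t is then an integral power series in the parameter s defined by u = ∑ α^k
s^(p^k) / p^k.

In terms of s the derivation D = d/du is integral, and du is modulo p an eigenvector of the Cartier
operator with eigenvalue α. Hence D^p ≡ α D ≡ A_p D mod p (`iterate_der_prime`). So D^(N-a) (A_p D -
D^p)^a maps ℤ_p[[s]] into p^a ℤ_p[[s]], and the constant term of its value at f is the Kummer sum of
m! times the u-coefficients of f (`kummer_sum`).

The function x = t^(-2) has a pole. Since u is s times a series in s^(p-1), expansions split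
according to exponents modulo p - 1, and (p-1) ∤ 10n says that the relevant class contains no polar
term (`kummer_congruence`). For y, use 4y = d(x²)/du and an antiderivative of x², namely ∫ t^(-4) (1
- t^10)^(-1/2) dt = t^(-3) G(t). Here G is integral because 10k - 3 divides b_k p-adically
(`dvd_invSqrtCoeff`). The pole of order 3 accounts for the range a ≤ 10n - 3. -/

lemma iterate_derivation_mul (D : Derivation R A A) (n : ℕ) (a b : A) :
    D^[n] (a * b) =
      ∑ ij ∈ Finset.HasAntidiagonal.antidiagonal n, n.choose ij.1 • (D^[ij.1] a * D^[ij.2] b) := by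
  induction n with
  | zero => simp
  | succ n ih =>
    rw [Finset.sum_antidiagonal_choose_succ_nsmul (M := A)
      (fun i j => D^[i] a * D^[j] b) n, Function.iterate_succ_apply', ih, map_sum,
      ← Finset.sum_add_distrib]
    refine Finset.sum_congr rfl fun ij hij => ?_
    rw [Finset.HasAntidiagonal.mem_antidiagonal] at hij
    have h : n.choose ij.2 = n.choose ij.1 := by
      rw [← hij, add_comm]
      exact (Nat.choose_symm_add (a := ij.2) (b := ij.1))
    rw [map_nsmul, Derivation.leibniz, Function.iterate_succ_apply', Function.iterate_succ_apply',
      smul_eq_mul, smul_eq_mul, h, ← smul_add]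
    congr 1
    ring

lemma iterate_prime_derivation_mul (p : ℕ) [Fact p.Prime] [CharP A p] (D : Derivation R A A)
    (a b : A) : D^[p] (a * b) = D^[p] a * b + a * D^[p] b := by
  have hp : p.Prime := Fact.out
  rw [iterate_derivation_mul, Finset.Nat.sum_antidiagonal_eq_sum_range_succ_mk,
    Finset.sum_range_succ, ← Nat.succ_pred_eq_of_pos hp.pos, Finset.sum_range_succ',
    Finset.sum_eq_zero]
  · simp [add_comm]
  · intro i hi
    rw [Finset.mem_range] at hi
    have : (p : ℕ) ∣ p.choose (i + 1) :=
      hp.dvd_choose_self (by omega) (by have := hp.pos; simp only [Nat.pred_eq_sub_one] at hi; omega)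
    rw [Nat.succ_pred_eq_of_pos hp.pos, nsmul_eq_mul, (CharP.cast_eq_zero_iff A p _).2 this,
      zero_mul]

lemma iterate_prime_derivation_pow (p : ℕ) [Fact p.Prime] [CharP A p] (D : Derivation R A A)
    (a : A) (n : ℕ) : D^[p] (a ^ (n + 1)) = (n + 1) * a ^ n * D^[p] a := by
  induction n with
  | zero => simp
  | succ n ih =>
    rw [pow_succ, iterate_prime_derivation_mul, ih]
    push_cast
    ring

end IteratedDerivation

/-! ### Normal form of powers of the operator g d/dX. -/

section Normal

variable {R : Type*} [CommRing R]

/-- The derivation `g d/dX`. -/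
def der (g : R⟦X⟧) : Derivation R R⟦X⟧ R⟦X⟧ := g • derivative R

lemma der_apply (g f : R⟦X⟧) : der g f = g * d⁄dX R f := rfl

/-- The coefficients of the normal form `(g ∂)^n g = ∑ j, P j ∂^j`. -/
def normalCoeff (g : R⟦X⟧) : ℕ → ℕ → R⟦X⟧
  | 0, 0 => g
  | 0, _ + 1 => 0
  | n + 1, 0 => g * d⁄dX R (normalCoeff g n 0)
  | n + 1, j + 1 => g * d⁄dX R (normalCoeff g n (j + 1)) + g * normalCoeff g n j

lemma normalCoeff_eq_zero (g : R⟦X⟧) {n j : ℕ} (h : n < j) : normalCoeff g n j = 0 := by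
  induction n generalizing j with
  | zero => obtain ⟨j, rfl⟩ := Nat.exists_eq_succ_of_ne_zero (by omega : j ≠ 0); rfl
  | succ n ih =>
    obtain ⟨j, rfl⟩ := Nat.exists_eq_succ_of_ne_zero (by omega : j ≠ 0)
    rw [normalCoeff, ih (by omega), ih (by omega)]
    simp

lemma normalCoeff_self (g : R⟦X⟧) (n : ℕ) : normalCoeff g n n = g ^ (n + 1) := by
  induction n with
  | zero => simp [normalCoeff]
  | succ n ih =>
    rw [normalCoeff, ih, normalCoeff_eq_zero g (Nat.lt_succ_self n)]
    simp [pow_succ']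

lemma iterate_der_mul (g f : R⟦X⟧) (n : ℕ) :
    (der g)^[n] (g * f) = ∑ j ∈ Finset.range (n + 1), normalCoeff g n j * (d⁄dX R)^[j] f := by
  induction n with
  | zero => simp [normalCoeff]
  | succ n ih =>
    rw [Function.iterate_succ_apply', ih, map_sum]
    simp only [der_apply, Derivation.leibniz, smul_eq_mul, Finset.sum_add_distrib,
      ← Function.iterate_succ_apply']
    rw [Finset.sum_range_succ' _ (n + 1)]
    simp only [normalCoeff, add_mul, Finset.sum_add_distrib]
    rw [add_comm (∑ x ∈ Finset.range (n + 1), g * d⁄dX R (normalCoeff g n (x + 1)) * _), add_assoc]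
    congr 1
    · exact Finset.sum_congr rfl fun j _ => by ring
    · rw [Finset.sum_range_succ', Finset.sum_range_succ (fun x => g * d⁄dX R (normalCoeff g n (x+1)) *
        (d⁄dX R)^[x+1] f) n, normalCoeff_eq_zero g (Nat.lt_succ_self n), map_zero, mul_zero, zero_mul,
        add_zero]
      congr 1
      · exact Finset.sum_congr rfl fun j _ => by ring
      · ring

end Normal

/-! ### The Cartier operator and p-th powers of derivations. -/

section CharP

variable {p : ℕ} [Fact p.Prime]

instance charPPowerSeries : CharP (ZMod p)⟦X⟧ p :=
  charP_of_injective_ringHom (f := (C : ZMod p →+* (ZMod p)⟦X⟧)) (C_injective) p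

lemma iterate_derivative_prime (f : (ZMod p)⟦X⟧) : (d⁄dX (ZMod p))^[p] f = 0 := by
  ext k
  have h : p ∣ (k + 1).ascFactorial p :=
    (Nat.dvd_factorial (Fact.out : p.Prime).pos le_rfl).trans (Nat.factorial_dvd_ascFactorial _ _)
  rw [coeff_iterate_derivative, (ZMod.natCast_eq_zero_iff _ _).2 h, zero_mul, map_zero]

/-- The hypothesis says that h dX is an eigenvector of the Cartier operator. Differentiating p - 1
times multiplies by (k+1)⋯(k+p-1), which modulo p is 0 unless p ∣ k, and then is -1 by Wilson; over
the prime field h^p = h(X^p). -/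
lemma iterate_derivative_pred (h : (ZMod p)⟦X⟧) (a : ZMod p)
    (hh : ∀ m, coeff (p * m + (p - 1)) h = a * coeff m h) :
    (d⁄dX (ZMod p))^[p - 1] h = -(C a * h ^ p) := by
  have hp : p.Prime := Fact.out
  have hF : h ^ p = expand p hp.ne_zero h := by
    have := MvPowerSeries.map_frobenius_expand p hp.ne_zero (f := h)
    rw [ZMod.frobenius_zmod] at this
    rw [← this]
    exact (congr_fun PowerSeries.map_id (expand p hp.ne_zero h))
  ext k
  rw [hF, coeff_iterate_derivative, map_neg, coeff_C_mul, coeff_expand]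
  split_ifs with hk
  · obtain ⟨m, rfl⟩ := hk
    rw [Nat.mul_div_cancel_left _ hp.pos, hh, Nat.ascFactorial_eq_prod_range, Nat.cast_prod]
    have : ∀ i ∈ Finset.range (p - 1), ((p * m + 1 + i : ℕ) : ZMod p) = ((i + 1 : ℕ) : ZMod p) := by
      intro i _
      push_cast
      simp [add_comm]
    rw [Finset.prod_congr rfl this, ← Nat.cast_prod, Finset.prod_range_add_one_eq_factorial,
      ZMod.wilsons_lemma]
    ring
  · rw [mul_zero, neg_zero, Nat.ascFactorial_eq_prod_range]
    have : p ∣ ∏ i ∈ Finset.range (p - 1), (k + 1 + i) := by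
      have hk' : k % p ≠ 0 := fun h => hk (Nat.dvd_of_mod_eq_zero h)
      have hlt := Nat.mod_lt k hp.pos
      refine (Dvd.intro_left (k / p + 1) ?_ : p ∣ k + 1 + (p - 1 - k % p)).trans
        (Finset.dvd_prod_of_mem (fun i => k + 1 + i) (Finset.mem_range.2 (by omega)))
      have := Nat.div_add_mod k p
      rw [add_mul, mul_comm (k / p) p]
      omega
    rw [(ZMod.natCast_eq_zero_iff _ _).2 this, zero_mul]

lemma iterate_derivative_X_pow (i n : ℕ) :
    (d⁄dX (ZMod p))^[i] (X ^ n) = C (n.descFactorial i : ZMod p) * X ^ (n - i) := by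
  induction i with
  | zero => simp
  | succ i ih =>
    rw [Function.iterate_succ_apply', ih, Derivation.leibniz, derivative_C, derivative_pow,
      Nat.descFactorial_succ, Nat.cast_mul, map_mul, ← Nat.sub_sub]
    simp
    ring

/-- The p-th iterate D^p is again a derivation, so D^p(X^(j+1)) = (j+1) X^j D^p X. In the normal
form the terms beyond j kill X^(j+1) and those strictly between 0 and j vanish by induction. What is
left is (j+1)! P_j = 0, and (j+1)! is a unit. -/
lemma normalCoeff_prime (g : (ZMod p)⟦X⟧) {j : ℕ} (h0 : 0 < j) (hj : j + 1 < p) :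
    normalCoeff g (p - 1) j = 0 := by
  have hp : p.Prime := Fact.out
  have key : ∀ f : (ZMod p)⟦X⟧, (der g)^[p] f =
      ∑ i ∈ Finset.range p, normalCoeff g (p - 1) i * (d⁄dX (ZMod p))^[i + 1] f := by
    intro f
    obtain ⟨q, rfl⟩ : ∃ q, p = q + 1 := ⟨p - 1, by have := hp.pos; omega⟩
    rw [Function.iterate_succ_apply, der_apply, iterate_der_mul]
    simp only [← Function.iterate_succ_apply, Nat.add_sub_cancel]
  have hX : (der g)^[p] X = normalCoeff g (p - 1) 0 := by
    rw [key, Finset.sum_eq_single_of_mem 0 (Finset.mem_range.2 hp.pos)]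
    · simp
    · intro i _ hi
      have h := iterate_derivative_X_pow (p := p) (i + 1) 1
      rw [pow_one, Nat.descFactorial_eq_zero_iff_lt.2 (by omega)] at h
      simp [h, -Function.iterate_succ]
  induction j using Nat.strong_induction_on with
  | _ j ih =>
    have h1 := iterate_prime_derivation_pow p (der g) X j
    rw [hX, key, ← Finset.sum_subset (Finset.range_subset_range.2 (show j + 1 ≤ p by omega)),
      Finset.sum_range_succ, Finset.sum_eq_single_of_mem 0 (Finset.mem_range.2 h0)] at h1
    · simp only [iterate_derivative_X_pow] at h1
      have h2 : normalCoeff g (p - 1) j * C ((j + 1).descFactorial (j + 1) : ZMod p) = 0 := by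
        simp only [zero_add, Nat.descFactorial_one, Nat.add_sub_cancel, Nat.sub_self, pow_zero,
          mul_one] at h1
        push_cast at h1
        have : (C ((j : ZMod p) + 1)) = ((j : (ZMod p)⟦X⟧) + 1) := by simp
        rw [this] at h1
        linear_combination h1
      refine (mul_eq_zero.1 h2).resolve_right ?_
      rw [Nat.descFactorial_self, map_eq_zero_iff _ C_injective, ZMod.natCast_eq_zero_iff,
        hp.dvd_factorial]
      omega
    · intro i hi hi0
      rw [Finset.mem_range] at hi
      rw [ih i hi (by omega) (by omega), zero_mul]
    · intro i _ hi
      rw [Finset.mem_range, not_lt] at hi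
      rw [iterate_derivative_X_pow, Nat.descFactorial_eq_zero_iff_lt.2 (by omega)]
      simp

/-- A derivation of height one: if `ω = h dX` satisfies `C ω = a ω` for the Cartier operator, then
the dual derivation `D` satisfies `D^p = a D`. -/
theorem iterate_der_prime {g h : (ZMod p)⟦X⟧} (hgh : g * h = 1) (a : ZMod p)
    (hh : ∀ m, coeff (p * m + (p - 1)) h = a * coeff m h) (f : (ZMod p)⟦X⟧) :
    (der g)^[p] f = C a * der g f := by
  have hp : p.Prime := Fact.out
  have key : ∀ f : (ZMod p)⟦X⟧, (der g)^[p - 1] (g * f) =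
      normalCoeff g (p - 1) 0 * f + g ^ p * (d⁄dX (ZMod p))^[p - 1] f := by
    intro f
    have h2 := hp.two_le
    have h3 := normalCoeff_self g (p - 1)
    rw [Nat.sub_add_cancel hp.pos] at h3
    rw [iterate_der_mul, Finset.sum_range_succ, h3, Finset.sum_eq_single_of_mem 0
      (Finset.mem_range.2 (by omega))]
    · simp
    · intro j hj hj0
      rw [Finset.mem_range] at hj
      rw [normalCoeff_prime g (by omega) (by omega), zero_mul]
  have h0 : (der g)^[p - 1] (1 : (ZMod p)⟦X⟧) = 0 := by
    obtain ⟨q, hq⟩ : ∃ q, p - 1 = q + 1 := ⟨p - 2, by have := hp.two_le; omega⟩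
    rw [hq, Function.iterate_succ_apply, Derivation.map_one_eq_zero, iterate_map_zero]
  -- Since g h = 1 is killed by D, this gives P_0 h = -g^p ∂^(p-1) h = a, that is, P_0 = a g.
  have h1 := key h
  rw [hgh, h0, iterate_derivative_pred h a hh] at h1
  have h2 : (der g)^[p] f = (der g)^[p - 1] (g * d⁄dX (ZMod p) f) := by
    rw [← der_apply, ← Function.iterate_succ_apply, Nat.succ_eq_add_one, Nat.sub_add_cancel hp.pos]
  have h3 : (d⁄dX (ZMod p))^[p - 1] (d⁄dX (ZMod p) f) = 0 := by
    rw [← Function.iterate_succ_apply, Nat.succ_eq_add_one, Nat.sub_add_cancel hp.pos,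
      iterate_derivative_prime]
  rw [h2, key, h3, der_apply, mul_zero, add_zero]
  have h4 : g ^ p * h ^ p = 1 := by rw [← mul_pow, hgh, one_pow]
  linear_combination (-(g * d⁄dX (ZMod p) f)) * h1 - normalCoeff g (p - 1) 0 * d⁄dX (ZMod p) f * hgh
    + C a * g * d⁄dX (ZMod p) f * h4

end CharP

end CurveExpansion

end

noncomputable section

namespace CurveExpansion

/-! ### Products with the multiples of `p` removed. -/

section PrimeToP

/-- `n` with the value replaced by `1` at the multiples of `p`. -/
def primeTo (p n : ℕ) : ℕ := if p ∣ n then 1 else n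

/-- `n` with the value replaced by `1` away from the multiples of `p`. -/
def multOf (p n : ℕ) : ℕ := if p ∣ n then n else 1

lemma primeTo_mul_multOf (p n : ℕ) : primeTo p n * multOf p n = n := by
  unfold primeTo multOf
  split_ifs <;> simp

/-- The product of the numbers `2 i + c` prime to `p`, for `i < K`. -/
def oddProd (p c K : ℕ) : ℕ := ∏ i ∈ Finset.range K, primeTo p (2 * i + c)

lemma not_dvd_oddProd {p : ℕ} (hp : p.Prime) (c K : ℕ) : ¬ p ∣ oddProd p c K := by
  rw [oddProd, hp.prime.dvd_finsetProd_iff]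
  rintro ⟨i, -, h⟩
  unfold primeTo at h
  split_ifs at h with h'
  · exact hp.one_lt.ne' (Nat.dvd_one.1 h)
  · exact h' h

/-- By `hqc` the first q factors contain no multiple of p. Each later block of p factors contains
exactly one, at offset i₀, and it equals p (2j + c). -/
lemma prod_multOf {p q c i₀ : ℕ} (hp : p.Prime) (hp2 : 2 < p) (hi₀ : i₀ < p) (hc : 0 < c)
    (hqc : 2 * q + c < p + 2) (h : 2 * (q + i₀) + c = p * c) (k : ℕ) :
    ∏ i ∈ Finset.range (k * p + q), multOf p (2 * i + c) =
      p ^ k * ∏ j ∈ Finset.range k, (2 * j + c) := by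
  induction k with
  | zero =>
    rw [zero_mul, zero_add, pow_zero, Finset.prod_range_zero, mul_one]
    refine Finset.prod_eq_one fun i hi => ?_
    rw [Finset.mem_range] at hi
    exact if_neg (Nat.not_dvd_of_pos_of_lt (by omega) (by omega))
  | succ k ih =>
    rw [show (k + 1) * p + q = (k * p + q) + p by ring, Finset.prod_range_add, ih,
      Finset.prod_eq_single_of_mem i₀ (Finset.mem_range.2 hi₀), Finset.prod_range_succ]
    · have h1 : 2 * (k * p + q + i₀) + c = p * (2 * k + c) := by linear_combination h
      rw [multOf, h1, if_pos (dvd_mul_right _ _)]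
      ring
    · intro i hi hne
      rw [Finset.mem_range] at hi
      refine if_neg fun hd => hne ?_
      have h1 : (p : ℤ) ∣ 2 * ((i : ℤ) - i₀) := by
        have h2 : (p : ℤ) ∣ 2 * (k * p + q + i) + c := by exact_mod_cast hd
        have h3 : (p : ℤ) ∣ 2 * (k * p + q + i₀) + c :=
          ⟨2 * k + c, by have : (2 * (q + i₀) + c : ℤ) = p * c := by exact_mod_cast h
                         linear_combination this⟩
        have := dvd_sub h2 h3
        rwa [show (2 * (k * p + q + i) + c - (2 * (k * p + q + i₀) + c) : ℤ) =
          2 * ((i : ℤ) - i₀) by ring] at this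
      have h4 : (p : ℤ) ∣ (i : ℤ) - i₀ := by
        refine (Int.Prime.dvd_mul' hp h1).resolve_left fun h5 => ?_
        have := Int.le_of_dvd (by norm_num) h5
        omega
      have := Int.eq_zero_of_abs_lt_dvd h4 (by rw [abs_lt]; constructor <;> omega)
      omega

open Classical in
/-- The product of the units of `ZMod n`. -/
def unitProd (n : ℕ) [NeZero n] : ZMod n := ∏ z : ZMod n, if IsUnit z then z else 1

lemma prod_range_zmod {M : Type*} [CommMonoid M] (n : ℕ) [NeZero n] (G : ZMod n → M) :
    ∏ i ∈ Finset.range n, G (i : ZMod n) = ∏ z : ZMod n, G z := by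
  refine Finset.prod_nbij' (fun i => (i : ZMod n)) ZMod.val ?_ ?_ ?_ ?_ ?_
  · simp
  · intro z _
    exact Finset.mem_range.2 (ZMod.val_lt z)
  · intro i hi
    exact ZMod.val_cast_of_lt (Finset.mem_range.1 hi)
  · intro z _
    exact ZMod.natCast_zmod_val z
  · simp

/-- A form of Wilson's theorem. -/
lemma oddProd_add {p : ℕ} (hp : p.Prime) (hp2 : 2 < p) (c K e : ℕ) [NeZero (p ^ (e + 1))] :
    (oddProd p c (K + p ^ (e + 1)) : ZMod (p ^ (e + 1))) =
      oddProd p c K * unitProd (p ^ (e + 1)) := by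
  classical
  have hcop : ∀ n : ℕ, IsUnit (n : ZMod (p ^ (e + 1))) ↔ ¬ p ∣ n := fun n => by
    rw [ZMod.isUnit_iff_coprime, Nat.coprime_pow_right_iff (Nat.succ_pos e), Nat.coprime_comm,
      hp.coprime_iff_not_dvd]
  have hcast : ∀ n : ℕ, (primeTo p n : ZMod (p ^ (e + 1))) =
      if IsUnit (n : ZMod (p ^ (e + 1))) then (n : ZMod (p ^ (e + 1))) else 1 := fun n => by
    have := hcop n
    unfold primeTo
    by_cases h : p ∣ n <;> simp_all
  rw [oddProd, Finset.prod_range_add, Nat.cast_mul, ← oddProd, Nat.cast_prod]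
  congr 1
  have h2 : IsUnit (2 : ZMod (p ^ (e + 1))) := by
    have := (hcop 2).2 (Nat.not_dvd_of_pos_of_lt two_pos hp2)
    exact_mod_cast this
  have hbij : Function.Bijective fun z : ZMod (p ^ (e + 1)) =>
      2 * ((K : ZMod (p ^ (e + 1))) + z) + (c : ZMod (p ^ (e + 1))) := by
    refine (Finite.injective_iff_bijective).1 fun a b hab => ?_
    exact add_left_cancel (h2.mul_left_cancel (add_right_cancel hab))
  rw [unitProd, ← hbij.prod_comp, ← prod_range_zmod]
  refine Finset.prod_congr rfl fun i _ => ?_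
  rw [hcast]
  push_cast
  rfl

end PrimeToP

/-! ### Congruences for binom(2k, k) / 4^k and the unit root. -/

section Coefficients

variable (p : ℕ) [Fact p.Prime]

/-- The coefficients `binom(2k, k) / 4^k` of `(1 - X)^(-1/2)`. -/
def invSqrtCoeff (k : ℕ) : ℤ_[p] := k.centralBinom * Ring.inverse 4 ^ k

variable {p}

lemma isUnit_natCast {n : ℕ} (h : ¬ p ∣ n) : IsUnit (n : ℤ_[p]) := by
  rw [PadicInt.isUnit_iff]
  have := PadicInt.norm_int_lt_one_iff_dvd (p := p) (n : ℤ)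
  rw [Int.natCast_dvd_natCast, Int.cast_natCast] at this
  exact le_antisymm (PadicInt.norm_le_one _) (not_lt.1 fun h' => h (this.1 h'))

lemma isUnit_intCast {n : ℤ} (h : ¬ (p : ℤ) ∣ n) : IsUnit (n : ℤ_[p]) := by
  rw [PadicInt.isUnit_iff]
  exact le_antisymm (PadicInt.norm_le_one _)
    (not_lt.1 fun h' => h ((PadicInt.norm_int_lt_one_iff_dvd n).1 h'))

/-- Divisibility by an integer in `ℤ_[p]` only depends on its `p`-part. -/
lemma intCast_dvd {n : ℤ} (hn : n ≠ 0) {x : ℤ_[p]}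
    (h : ∀ v : ℕ, (p : ℤ) ^ v ∣ n → (p : ℤ_[p]) ^ v ∣ x) : (n : ℤ_[p]) ∣ x := by
  have hp : p.Prime := Fact.out
  have hfin : FiniteMultiplicity (p : ℤ) n :=
    Int.finiteMultiplicity_iff.2 ⟨by simpa using hp.ne_one, hn⟩
  obtain ⟨m, hm, hm'⟩ := hfin.exists_eq_pow_mul_and_not_dvd
  rw [hm]
  push_cast
  exact (isUnit_intCast hm').mul_right_dvd.2 (h _ (pow_multiplicity_dvd _ _))

lemma invSqrtCoeff_zero : invSqrtCoeff p 0 = 1 := by simp [invSqrtCoeff]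

variable {q : ℕ} (hq : p = 10 * q + 1)
include hq

lemma ten_lt : 10 < p := by
  have := (Fact.out : p.Prime).one_lt
  omega

lemma isUnit_four : IsUnit (4 : ℤ_[p]) := by
  have := isUnit_natCast (p := p) (n := 4)
    (Nat.not_dvd_of_pos_of_lt (by norm_num) (by have := ten_lt hq; omega))
  exact_mod_cast this

lemma four_mul_inverse : (4 : ℤ_[p]) * Ring.inverse 4 = 1 := Ring.mul_inverse_cancel _ (isUnit_four hq)

lemma invSqrtCoeff_succ (k : ℕ) :
    (2 * k + 2) * invSqrtCoeff p (k + 1) = (2 * k + 1) * invSqrtCoeff p k := by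
  have h : ((k : ℤ_[p]) + 1) * (k + 1).centralBinom = 2 * (2 * k + 1) * k.centralBinom := by
    exact_mod_cast Nat.succ_mul_centralBinom_succ k
  rw [invSqrtCoeff, invSqrtCoeff, pow_succ]
  linear_combination 2 * Ring.inverse (4 : ℤ_[p]) ^ k * Ring.inverse 4 * h +
    (2 * k + 1) * k.centralBinom * Ring.inverse (4 : ℤ_[p]) ^ k * four_mul_inverse hq

lemma invSqrtCoeff_mul_prod (k : ℕ) :
    invSqrtCoeff p k * ((∏ i ∈ Finset.range k, (2 * i + 2) : ℕ) : ℤ_[p]) =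
      ((∏ i ∈ Finset.range k, (2 * i + 1) : ℕ) : ℤ_[p]) := by
  induction k with
  | zero => simp [invSqrtCoeff_zero]
  | succ k ih =>
    rw [Finset.prod_range_succ, Finset.prod_range_succ, Nat.cast_mul, Nat.cast_mul, ← ih]
    have := invSqrtCoeff_succ hq k
    push_cast
    linear_combination (∏ i ∈ Finset.range k, (2 * (i : ℤ_[p]) + 2)) * this

/-- The coefficient is ∏ (2i+1) / ∏ (2i+2). In the products of length kp + q the multiples of p
contribute p^k times the corresponding products of length k, so they reproduce the coefficient of
index k; the remaining factors are units. -/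
lemma invSqrtCoeff_mul_oddProd (k : ℕ) :
    invSqrtCoeff p (k * p + q) * (oddProd p 2 (k * p + q) : ℤ_[p]) =
      invSqrtCoeff p k * (oddProd p 1 (k * p + q) : ℤ_[p]) := by
  have hp : p.Prime := Fact.out
  have h10 := ten_lt hq
  have e : ∀ c : ℕ, (∏ i ∈ Finset.range (k * p + q), (2 * i + c)) =
      oddProd p c (k * p + q) * ∏ i ∈ Finset.range (k * p + q), multOf p (2 * i + c) := fun c => by
    rw [oddProd, ← Finset.prod_mul_distrib]
    exact Finset.prod_congr rfl fun i _ => (primeTo_mul_multOf p _).symm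
  have h := invSqrtCoeff_mul_prod hq (k * p + q)
  -- The offsets solve 2(q + i₀) + c = pc for c = 1 and c = 2.
  rw [e 1, e 2, prod_multOf hp (c := 1) (i₀ := 4 * q) (by omega) (by omega) (by omega) (by omega) (by omega),
    prod_multOf hp (c := 2) (i₀ := 9 * q) (by omega) (by omega) (by omega) (by omega) (by omega)] at h
  have h' := invSqrtCoeff_mul_prod hq k
  have hne : ((p ^ k * ∏ i ∈ Finset.range k, (2 * i + 2) : ℕ) : ℤ_[p]) ≠ 0 := by
    rw [Nat.cast_ne_zero]
    exact mul_ne_zero (pow_ne_zero _ hp.ne_zero) (Finset.prod_ne_zero_iff.2 fun i _ => by omega)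
  apply mul_right_cancel₀ hne
  push_cast at h h' ⊢
  linear_combination h - (oddProd p 1 (k * p + q) : ℤ_[p]) * p ^ k * h'

/-- The ratios of the coefficients with indices `10 k + 1` and `p (10 k + 1)`. -/
lemma exists_ratio : ∃ r : ℕ → ℤ_[p],
    (∀ k, invSqrtCoeff p (k * p + q) = r k * invSqrtCoeff p k) ∧
      ∀ k e, (p : ℤ_[p]) ^ (e + 1) ∣ r (k + p ^ e) - r k := by
  have hp : p.Prime := Fact.out
  have h10 := ten_lt hq
  have hu : ∀ k, IsUnit (oddProd p 2 (k * p + q) : ℤ_[p]) := fun k =>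
    isUnit_natCast (not_dvd_oddProd hp _ _)
  have hc : ∀ k, (oddProd p 2 (k * p + q) : ℤ_[p]) * Ring.inverse (oddProd p 2 (k * p + q) : ℤ_[p]) =
      1 := fun k => Ring.mul_inverse_cancel _ (hu k)
  refine ⟨fun k => oddProd p 1 (k * p + q) * Ring.inverse (oddProd p 2 (k * p + q) : ℤ_[p]),
    fun k => ?_, fun k e => ?_⟩
  · linear_combination Ring.inverse (oddProd p 2 (k * p + q) : ℤ_[p]) * invSqrtCoeff_mul_oddProd hq k
      - invSqrtCoeff p (k * p + q) * hc k
  · rw [← (hu (k + p ^ e)).dvd_mul_left, ← (hu k).dvd_mul_left]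
    have h : (p : ℤ_[p]) ^ (e + 1) ∣
        (oddProd p 2 (k * p + q) : ℤ_[p]) * oddProd p 1 ((k + p ^ e) * p + q) -
          (oddProd p 2 ((k + p ^ e) * p + q) : ℤ_[p]) * oddProd p 1 (k * p + q) := by
      have : NeZero (p ^ (e + 1)) := ⟨pow_ne_zero _ hp.ne_zero⟩
      have h1 : ((p ^ (e + 1) : ℕ) : ℤ) ∣
          (oddProd p 2 (k * p + q) : ℤ) * oddProd p 1 ((k + p ^ e) * p + q) -
            (oddProd p 2 ((k + p ^ e) * p + q) : ℤ) * oddProd p 1 (k * p + q) := by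
        rw [← ZMod.intCast_zmod_eq_zero_iff_dvd, show (k + p ^ e) * p + q =
          k * p + q + p ^ (e + 1) by ring]
        push_cast
        -- Numerator and denominator acquire the same factor `unitProd`, so its actual value is
        -- irrelevant.
        rw [oddProd_add hp (by omega), oddProd_add hp (by omega)]
        ring
      have := map_dvd (Int.castRingHom ℤ_[p]) h1
      simpa using this
    convert h using 1
    linear_combination (oddProd p 2 (k * p + q) : ℤ_[p]) * oddProd p 1 ((k + p ^ e) * p + q) *
      hc (k + p ^ e) - (oddProd p 2 ((k + p ^ e) * p + q) : ℤ_[p]) * oddProd p 1 (k * p + q) * hc k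

/-- The unit root. -/
lemma exists_unitRoot : ∃ α : ℤ_[p], ∀ k,
    (p : ℤ_[p]) * ((10 * k + 1 : ℕ) : ℤ_[p]) ∣
      invSqrtCoeff p (k * p + q) - α * invSqrtCoeff p k := by
  have hp : p.Prime := Fact.out
  obtain ⟨r, hr, hstep⟩ := exists_ratio hq
  have hsteps : ∀ e m k, (p : ℤ_[p]) ^ (e + 1) ∣ r (k + m * p ^ e) - r k := by
    intro e m k
    induction m with
    | zero => simp
    | succ m ih =>
      have := dvd_add (hstep (k + m * p ^ e) e) ih
      rwa [sub_add_sub_cancel, show k + m * p ^ e + p ^ e = k + (m + 1) * p ^ e by ring] at this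
  have hcongr : ∀ e k l, (p ^ e : ℕ) ∣ 10 * k + 1 → (p ^ e : ℕ) ∣ 10 * l + 1 →
      (p : ℤ_[p]) ^ (e + 1) ∣ r k - r l := by
    intro e
    suffices H : ∀ k l, l ≤ k → (p ^ e : ℕ) ∣ 10 * k + 1 → (p ^ e : ℕ) ∣ 10 * l + 1 →
        (p : ℤ_[p]) ^ (e + 1) ∣ r k - r l by
      intro k l hk hl
      rcases le_total l k with h | h
      · exact H k l h hk hl
      · rw [dvd_sub_comm]
        exact H l k h hl hk
    intro k l hlk hk hl
    obtain ⟨d, rfl⟩ := Nat.exists_eq_add_of_le hlk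
    have h1 : p ^ e ∣ 10 * d := by
      have := Nat.dvd_sub hk hl
      rwa [show 10 * (l + d) + 1 - (10 * l + 1) = 10 * d by omega] at this
    have hcop : Nat.Coprime (p ^ e) 10 := by
      refine Nat.Coprime.pow_left _ ?_
      rw [hq]
      simp
    obtain ⟨m, rfl⟩ := hcop.dvd_of_dvd_mul_left h1
    rw [mul_comm (p ^ e)]
    exact hsteps e m l
  have hmod : ∀ e, 10 * ((p ^ e - 1) / 10) + 1 = p ^ e := by
    intro e
    have h1 : p ^ e % 10 = 1 := by rw [Nat.pow_mod, hq]; simp [Nat.add_mod]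
    omega
  -- The ratio r(k) is p-adically continuous in k, and α is its value at k = -1/10, approached along
  -- 10k + 1 = p^e.
  obtain ⟨α, hα⟩ := IsPrecomplete.prec (I := IsLocalRing.maximalIdeal ℤ_[p]) (M := ℤ_[p])
    inferInstance (f := fun e => r ((p ^ e - 1) / 10)) (by
      intro m n hmn
      rw [SModEq.sub_mem, smul_eq_mul, Ideal.mul_top, PadicInt.maximalIdeal_eq_span_p,
        Ideal.span_singleton_pow, Ideal.mem_span_singleton]
      refine (pow_dvd_pow _ (Nat.le_succ m)).trans (hcongr m _ _ ?_ ?_)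
      · rw [hmod]
      · rw [hmod]
        exact pow_dvd_pow _ hmn)
  have hα' : ∀ e k, (p ^ e : ℕ) ∣ 10 * k + 1 → (p : ℤ_[p]) ^ (e + 1) ∣ r k - α := by
    intro e k hk
    have h1 := hα (e + 1)
    rw [SModEq.sub_mem, smul_eq_mul, Ideal.mul_top, PadicInt.maximalIdeal_eq_span_p,
      Ideal.span_singleton_pow, Ideal.mem_span_singleton] at h1
    have h2 := hcongr e k ((p ^ (e + 1) - 1) / 10) hk (by
      rw [hmod]
      exact pow_dvd_pow _ (Nat.le_succ e))
    have := dvd_add h2 h1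
    rwa [sub_add_sub_cancel] at this
  refine ⟨α, fun k => ?_⟩
  rw [hr, ← sub_mul]
  refine Dvd.dvd.mul_right ?_ _
  have := intCast_dvd (p := p) (n := ((p * (10 * k + 1) : ℕ) : ℤ))
    (by rw [Int.natCast_ne_zero]; exact mul_ne_zero hp.ne_zero (by omega)) (x := r k - α) (by
      intro v hv
      rcases v with _ | v
      · simp
      · apply hα'
        have : p ^ (v + 1) ∣ p * (10 * k + 1) := by exact_mod_cast hv
        rw [pow_succ'] at this
        exact Nat.dvd_of_mul_dvd_mul_left hp.pos this)
  exact_mod_cast this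

/-- Modulo p = 10q + 1 one has 2(5q - i) ≡ -(2i + 1), which turns the numerator of binom(5q, q) into
(-1)^q times the product of odd numbers. -/
lemma hasseA_congr : (p : ℤ_[p]) ∣ (CurveInversion.hasseA p : ℤ_[p]) - invSqrtCoeff p q := by
  have hp : p.Prime := Fact.out
  have h1 : (p - 1) / 10 = q := by omega
  have h2 : (p - 1) / 2 = 5 * q := by omega
  have hfac : ∀ n : ℕ, (∏ i ∈ Finset.range n, (2 * i + 2)) = 2 ^ n * n.factorial := by
    intro n
    induction n with
    | zero => simp
    | succ n ih => rw [Finset.prod_range_succ, ih, Nat.factorial_succ]; ring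
  have hu : IsUnit ((2 ^ q * q.factorial : ℕ) : ℤ_[p]) := by
    apply isUnit_natCast
    have h10 := ten_lt hq
    rw [hp.dvd_mul, hp.dvd_factorial, not_or]
    refine ⟨fun h => ?_, by omega⟩
    have := Nat.le_of_dvd two_pos (hp.dvd_of_dvd_pow h)
    omega
  rw [← hu.dvd_mul_right, sub_mul]
  have h3 := invSqrtCoeff_mul_prod hq q
  rw [hfac] at h3
  rw [h3]
  have h4 : (p : ℤ) ∣ (CurveInversion.hasseA p) * ((2 ^ q * q.factorial : ℕ) : ℤ) -
      ((∏ i ∈ Finset.range q, (2 * i + 1) : ℕ) : ℤ) := by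
    rw [CurveInversion.hasseA, h1, h2, ← ZMod.intCast_zmod_eq_zero_iff_dvd]
    have h5 : (2 ^ q * q.factorial * (5 * q).choose q : ℕ) =
        ∏ i ∈ Finset.range q, (2 * (5 * q - i)) := by
      rw [Finset.prod_mul_distrib, Finset.prod_const, Finset.card_range,
        ← Nat.descFactorial_eq_prod_range, Nat.descFactorial_eq_factorial_mul_choose]
      ring
    have h6 : ((2 ^ q * q.factorial * (5 * q).choose q : ℕ) : ZMod p) =
        (-1) ^ q * ((∏ i ∈ Finset.range q, (2 * i + 1) : ℕ) : ZMod p) := by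
      rw [h5, Nat.cast_prod, Nat.cast_prod, ← Finset.card_range q, ← Finset.prod_const,
        Finset.card_range, ← Finset.prod_mul_distrib]
      refine Finset.prod_congr rfl fun i hi => ?_
      rw [Finset.mem_range] at hi
      have h7 : (2 * (5 * q - i)) + (2 * i + 1) = p := by omega
      have h8 : ((2 * (5 * q - i) : ℕ) : ZMod p) + ((2 * i + 1 : ℕ) : ZMod p) = 0 := by
        rw [← Nat.cast_add, h7, ZMod.natCast_self]
      linear_combination h8
    have h9 : ((-1 : ZMod p) ^ q) * (-1) ^ q = 1 := by rw [← mul_pow]; simp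
    push_cast at h6 ⊢
    linear_combination (-1) ^ q * h6 + (∏ i ∈ Finset.range q, (2 * (i : ZMod p) + 1)) * h9
  have := map_dvd (Int.castRingHom ℤ_[p]) h4
  simpa using this

/-- Kummer's theorem: the valuation is the number of carries in k + k, and a carry occurs at each of
the v lowest digits. -/
lemma pow_dvd_centralBinom {k v : ℕ} (h : (p : ℤ) ^ v ∣ 10 * k - 3) : p ^ v ∣ k.centralBinom := by
  have hp : p.Prime := Fact.out
  have h10 := ten_lt hq
  rw [hp.pow_dvd_iff_le_factorization (Nat.centralBinom_pos k).ne', Nat.centralBinom_eq_two_mul_choose,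
    Nat.factorization_choose hp (b := Nat.log p (2 * k) + v + 1) (by omega) (by omega)]
  have hsub : Finset.Icc 1 v ⊆ {i ∈ Finset.Ico 1 (Nat.log p (2 * k) + v + 1) |
      p ^ i ≤ k % p ^ i + (2 * k - k) % p ^ i} := by
    intro i hi
    rw [Finset.mem_Icc] at hi
    rw [Finset.mem_filter, Finset.mem_Ico, show 2 * k - k = k by omega]
    refine ⟨by omega, ?_⟩
    have hi10 : p ≤ p ^ i := Nat.le_self_pow (by omega) p
    have hmod : p ^ i % 10 = 1 := by rw [Nat.pow_mod, hq]; simp [Nat.add_mod]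
    have hlt : k % p ^ i < p ^ i := Nat.mod_lt _ (by omega)
    have hd : ((p ^ i : ℕ) : ℤ) ∣ 10 * ((k % p ^ i : ℕ) : ℤ) - 3 := by
      have h1 : ((p ^ i : ℕ) : ℤ) ∣ 10 * k - 3 := by
        push_cast
        exact (pow_dvd_pow _ hi.2).trans h
      have h2 := Nat.div_add_mod k (p ^ i)
      have h3 : ((p ^ i : ℕ) : ℤ) ∣ 10 * (((p ^ i : ℕ) : ℤ) * ((k / p ^ i : ℕ) : ℤ)) :=
        Dvd.intro_left (10 * ((k / p ^ i : ℕ) : ℤ)) (by ring)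
      have h4 := dvd_sub h1 h3
      have h5 : (k : ℤ) = ((p ^ i : ℕ) : ℤ) * ((k / p ^ i : ℕ) : ℤ) + ((k % p ^ i : ℕ) : ℤ) := by
        exact_mod_cast h2.symm
      rwa [show (10 * k - 3 - 10 * (((p ^ i : ℕ) : ℤ) * ((k / p ^ i : ℕ) : ℤ)) : ℤ) =
        10 * ((k % p ^ i : ℕ) : ℤ) - 3 by linear_combination 10 * h5] at h4
    generalize k % p ^ i = r at *
    generalize p ^ i = P at *
    obtain ⟨m, hm⟩ := hd
    have hm0 : 0 ≤ m := by
      by_contra hneg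
      have : (P : ℤ) * m ≤ (P : ℤ) * (-1) := mul_le_mul_of_nonneg_left (by omega) (by omega)
      omega
    have hm9 : m < 10 := by
      by_contra hbig
      have : (P : ℤ) * 10 ≤ (P : ℤ) * m := mul_le_mul_of_nonneg_left (by omega) (by omega)
      omega
    -- Here 10r - 3 = P m with P ≡ 1 mod 10 forces m = 7, so 10r = 7P + 3 and 2r ≥ P: a carry.
    interval_cases m <;> omega
  simpa using Finset.card_le_card hsub

lemma dvd_invSqrtCoeff (k : ℕ) : ((10 * k - 3 : ℤ) : ℤ_[p]) ∣ invSqrtCoeff p k := by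
  refine intCast_dvd (by omega) fun v hv => Dvd.dvd.mul_right ?_ _
  have := Nat.cast_dvd_cast (α := ℤ_[p]) (pow_dvd_centralBinom hq hv)
  rwa [Nat.cast_pow] at this

end Coefficients

end CurveExpansion

end

noncomputable section

namespace CurveExpansion

open PowerSeries

/-! ### Integrality of power series and the functional equation lemma. -/

section Subst

variable {R : Type*} [CommRing R]

lemma coeff_pow_eq_zero {g : R⟦X⟧} (hg : constantCoeff g = 0) {n m : ℕ} (h : n < m) :
    coeff n (g ^ m) = 0 :=
  X_pow_dvd_iff.1 (pow_dvd_pow_of_dvd (X_dvd_iff.2 hg) m) n h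

lemma coeff_subst_eq_sum {g : R⟦X⟧} (hg : constantCoeff g = 0) (f : R⟦X⟧) (n : ℕ) :
    coeff n (f.subst g) = ∑ m ∈ Finset.range (n + 1), coeff m f * coeff n (g ^ m) := by
  rw [coeff_subst' (HasSubst.of_constantCoeff_zero' hg)]
  refine finsum_eq_sum_of_support_subset _ fun m hm => ?_
  rw [Finset.coe_range, Set.mem_Iio]
  by_contra h
  refine hm ?_
  simp only [coeff_pow_eq_zero hg (show n < m by omega), smul_zero]

end Subst

section Integral

variable (p : ℕ) [Fact p.Prime]

/-- The power series with coefficients in `ℤ_[p]`. -/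
def integral : Subring ℚ_[p]⟦X⟧ := (PowerSeries.map (algebraMap ℤ_[p] ℚ_[p])).range

variable {p}

lemma mem_integral {f : ℚ_[p]⟦X⟧} : f ∈ integral p ↔ ∀ n, coeff n f ∈ PadicInt.subring p := by
  constructor
  · rintro ⟨g, rfl⟩ n
    rw [coeff_map]
    exact (coeff n g).2
  · intro h
    have h' : ∀ n, ∃ z : ℤ_[p], algebraMap ℤ_[p] ℚ_[p] z = coeff n f := fun n => ⟨⟨_, h n⟩, rfl⟩
    choose g hg using h'
    exact ⟨PowerSeries.mk g, by ext n; rw [coeff_map, coeff_mk, hg]⟩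

lemma coe_mem (x : ℤ_[p]) : (x : ℚ_[p]) ∈ PadicInt.subring p := x.2

lemma subst_mem_integral {f g : ℚ_[p]⟦X⟧} (hf : f ∈ integral p) (hg : g ∈ integral p)
    (hg0 : constantCoeff g = 0) : f.subst g ∈ integral p := by
  rw [mem_integral]
  intro n
  rw [coeff_subst_eq_sum hg0]
  exact sum_mem fun m _ => mul_mem (mem_integral.1 hf m) (mem_integral.1 (pow_mem hg m) n)

lemma C_dvd_iff {R : Type*} [CommRing R] (a : R) (f : R⟦X⟧) : C a ∣ f ↔ ∀ n, a ∣ coeff n f := by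
  constructor
  · rintro ⟨g, rfl⟩ n
    rw [coeff_C_mul]
    exact dvd_mul_right _ _
  · intro h
    choose g hg using h
    exact ⟨PowerSeries.mk g, by ext n; rw [coeff_C_mul, coeff_mk, hg]⟩

lemma map_toZMod_eq_zero_iff (f : ℤ_[p]⟦X⟧) :
    PowerSeries.map (PadicInt.toZMod (p := p)) f = 0 ↔ (p : ℤ_[p]⟦X⟧) ∣ f := by
  rw [show (p : ℤ_[p]⟦X⟧) = C (p : ℤ_[p]) by simp, C_dvd_iff, PowerSeries.ext_iff]
  refine forall_congr' fun n => ?_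
  rw [coeff_map, map_zero, ← RingHom.mem_ker, PadicInt.ker_toZMod, PadicInt.maximalIdeal_eq_span_p,
    Ideal.mem_span_singleton]

lemma dvd_pow_sub_expand (f : ℤ_[p]⟦X⟧) :
    (p : ℤ_[p]⟦X⟧) ∣ f ^ p - expand p (Fact.out : p.Prime).ne_zero f := by
  rw [← map_toZMod_eq_zero_iff, map_sub, map_pow, map_expand, sub_eq_zero]
  have := MvPowerSeries.map_frobenius_expand p (Fact.out : p.Prime).ne_zero
    (f := PowerSeries.map (PadicInt.toZMod (p := p)) f)
  rw [ZMod.frobenius_zmod] at this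
  rw [← this]
  exact (congr_fun PowerSeries.map_id _)

/-- Raising to the power p^v improves a congruence mod p to one mod p^(v+1). The extra factor m
compensates the denominator of the m-th coefficient of a logarithm. -/
lemma dvd_coeff_pow_sub_pow {x y : ℤ_[p]⟦X⟧} (h : (p : ℤ_[p]⟦X⟧) ∣ x - y) {m : ℕ} (hm : m ≠ 0)
    (n : ℕ) : (p : ℤ_[p]) * m ∣ coeff n (x ^ m - y ^ m) := by
  have hp : p.Prime := Fact.out
  have := intCast_dvd (p := p) (n := ((p * m : ℕ) : ℤ))
    (by rw [Int.natCast_ne_zero]; exact mul_ne_zero hp.ne_zero hm) (x := coeff n (x ^ m - y ^ m)) (by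
      intro v hv
      rcases v with _ | v
      · simp
      · have : p ^ (v + 1) ∣ p * m := by exact_mod_cast hv
        rw [pow_succ'] at this
        obtain ⟨k, rfl⟩ := Nat.dvd_of_mul_dvd_mul_left hp.pos this
        have h1 := (dvd_sub_pow_of_dvd_sub (p := p) h v).trans
          (sub_dvd_pow_sub_pow (x ^ p ^ v) (y ^ p ^ v) k)
        rw [← pow_mul, ← pow_mul, show (p : ℤ_[p]⟦X⟧) ^ (v + 1) = C ((p : ℤ_[p]) ^ (v + 1)) by simp,
          C_dvd_iff] at h1
        exact h1 n)
  exact_mod_cast this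

/-- The functional equation lemma, for a logarithm of height one. -/
theorem integral_of_subst_eq {F l τ : ℚ_[p]⟦X⟧} {α : ℤ_[p]}
    (hF0 : coeff 0 F = 0) (hF1 : coeff 1 F = 1)
    (hF : ∀ m : ℕ, (m : ℚ_[p]) * coeff m F ∈ PadicInt.subring p)
    (hFα : F - C ((α : ℚ_[p]) / p) * expand p (Fact.out : p.Prime).ne_zero F ∈ integral p)
    (hl : l = X + C ((α : ℚ_[p]) / p) * expand p (Fact.out : p.Prime).ne_zero l)
    (hτ0 : constantCoeff τ = 0) (hτ : F.subst τ = l) : τ ∈ integral p := by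
  have hp : p.Prime := Fact.out
  have hp0 : (p : ℚ_[p]) ≠ 0 := Nat.cast_ne_zero.2 hp.ne_zero
  rw [mem_integral]
  intro n
  induction n using Nat.strong_induction_on with
  | _ n ih =>
  rcases Nat.eq_zero_or_pos n with rfl | hn
  · rw [coeff_zero_eq_constantCoeff_apply, hτ0]
    exact zero_mem _
  -- By induction the truncation of τ below degree n is integral; only the n-th coefficient is in
  -- question.
  set t : ℚ_[p]⟦X⟧ := ((trunc n τ : Polynomial ℚ_[p]) : ℚ_[p]⟦X⟧) with ht
  have htc : ∀ m, coeff m t = if m < n then coeff m τ else 0 := fun m => by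
    rw [ht, Polynomial.coeff_coe, coeff_trunc]
  have ht0 : constantCoeff t = 0 := by
    rw [← coeff_zero_eq_constantCoeff_apply, htc, if_pos hn, coeff_zero_eq_constantCoeff_apply, hτ0]
  have hti : t ∈ integral p := by
    rw [mem_integral]
    intro m
    rw [htc]
    split_ifs with h
    · exact ih m h
    · exact zero_mem _
  have hdvd : (X : ℚ_[p]⟦X⟧) ^ n ∣ τ - t := by
    rw [X_pow_dvd_iff]
    intro m hm
    rw [map_sub, htc, if_pos hm, sub_self]
  have hlow : ∀ j < n, coeff j (F.subst t) = coeff j l := by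
    intro j hj
    rw [← hτ, coeff_subst_eq_sum ht0, coeff_subst_eq_sum hτ0]
    refine Finset.sum_congr rfl fun m _ => ?_
    have := X_pow_dvd_iff.1 (hdvd.trans (sub_dvd_pow_sub_pow τ t m)) j hj
    rw [map_sub, sub_eq_zero] at this
    rw [this]
  -- The n-th coefficient of τ enters only linearly, through F_1 = 1: in powers beyond the first, τ
  -- and t agree through degree n.
  have hn1 : coeff n l - coeff n (F.subst t) = coeff n τ := by
    rw [← hτ, coeff_subst_eq_sum ht0, coeff_subst_eq_sum hτ0, ← Finset.sum_sub_distrib,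
      Finset.sum_eq_single_of_mem 1 (Finset.mem_range.2 (by omega))]
    · rw [pow_one, pow_one, hF1, htc, if_neg (lt_irrefl n)]
      ring
    · intro m _ hm1
      rcases m with _ | _ | m
      · rw [hF0]; ring
      · exact absurd rfl hm1
      · have h1 : (X : ℚ_[p]⟦X⟧) ^ (n + 1) ∣ τ ^ (m + 2) - t ^ (m + 2) := by
          have e : τ ^ (m + 2) - t ^ (m + 2) =
              (τ - t) * τ ^ (m + 1) + (τ ^ (m + 1) - t ^ (m + 1)) * t := by ring
          rw [e, pow_succ]
          refine dvd_add (mul_dvd_mul hdvd ?_) (mul_dvd_mul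
            (hdvd.trans (sub_dvd_pow_sub_pow _ _ _)) (X_dvd_iff.2 ht0))
          exact (X_dvd_iff.2 hτ0).trans (dvd_pow_self _ (Nat.succ_ne_zero m))
        have := X_pow_dvd_iff.1 h1 n (Nat.lt_succ_self n)
        rw [map_sub] at this
        rw [← mul_sub, this, mul_zero]
  have hts : HasSubst t := HasSubst.of_constantCoeff_zero' ht0
  have htp0 : constantCoeff (t ^ p) = 0 := by rw [map_pow, ht0, zero_pow hp.ne_zero]
  have hte0 : constantCoeff (expand p hp.ne_zero t) = 0 := by rw [constantCoeff_expand, ht0]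
  have hcomp : (expand p hp.ne_zero F).subst t = F.subst (t ^ p) := by
    rw [expand_apply, subst_comp_subst_apply (HasSubst.X_pow hp.ne_zero) hts, subst_pow hts,
      subst_X hts]
  have hdiff : ∃ z ∈ PadicInt.subring p,
      coeff n (F.subst (t ^ p)) = coeff n (F.subst (expand p hp.ne_zero t)) + p * z := by
    obtain ⟨t', ht'⟩ := hti
    have hterm : ∀ m, ∃ z ∈ PadicInt.subring p,
        coeff m F * (coeff n ((t ^ p) ^ m) - coeff n ((expand p hp.ne_zero t) ^ m)) = p * z := by
      intro m
      rcases Nat.eq_zero_or_pos m with rfl | hm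
      · exact ⟨0, zero_mem _, by rw [hF0]; ring⟩
      · obtain ⟨z, hz⟩ := dvd_coeff_pow_sub_pow (dvd_pow_sub_expand t') hm.ne' n
        refine ⟨(m * coeff m F) * z, mul_mem (hF m) (coe_mem z), ?_⟩
        have h2 := congrArg (algebraMap ℤ_[p] ℚ_[p]) hz
        rw [← coeff_map, map_sub, map_pow, map_pow, map_pow, map_expand, ht', map_sub] at h2
        rw [h2]
        simp only [map_mul, map_natCast]
        change _ * (_ * _ * (z : ℚ_[p])) = _
        ring
    choose z hz hz' using hterm
    refine ⟨∑ m ∈ Finset.range (n + 1), z m, sum_mem fun m _ => hz m, ?_⟩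
    rw [coeff_subst_eq_sum htp0, coeff_subst_eq_sum hte0, Finset.mul_sum, ← Finset.sum_add_distrib]
    refine Finset.sum_congr rfl fun m _ => ?_
    rw [← hz' m]
    ring
  obtain ⟨z, hz, hz'⟩ := hdiff
  -- Substituting X^p only calls on coefficients of index n/p < n, where F(t) and l already agree.
  have hexp : coeff n (F.subst (expand p hp.ne_zero t)) = coeff n (expand p hp.ne_zero l) := by
    rw [show F.subst (expand p hp.ne_zero t) = expand p hp.ne_zero (F.subst t) from
      (expand_subst p hp.ne_zero hts F).symm, coeff_expand, coeff_expand]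
    split_ifs with h
    · exact hlow _ (Nat.div_lt_self hn hp.one_lt)
    · rfl
  have hG := mem_integral.1 (subst_mem_integral hFα hti ht0) n
  rw [subst_sub hts, subst_mul hts, map_sub, hcomp, subst_C] at hG
  change coeff n (F.subst t) - coeff n (C ((α : ℚ_[p]) / p) * F.subst (t ^ p)) ∈ _ at hG
  rw [coeff_C_mul, hz', hexp] at hG
  have hln := congrArg (coeff n) hl
  rw [map_add, coeff_C_mul] at hln
  have hX : coeff n (X : ℚ_[p]⟦X⟧) ∈ PadicInt.subring p := by
    rw [coeff_X]
    split_ifs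
    · exact one_mem _
    · exact zero_mem _
  -- F(t) is an integral series in t plus (α/p) F(t^p), and modulo integral terms (α/p) F(t^p) is
  -- (α/p) l(X^p), which cancels against l = X + (α/p) l(X^p).
  have hfin : coeff n τ = coeff n (X : ℚ_[p]⟦X⟧) - α * z - (coeff n (F.subst t) -
      α / p * (coeff n (expand p hp.ne_zero l) + p * z)) := by
    rw [← hn1]
    field_simp
    have : (p : ℚ_[p]) * coeff n l = p * coeff n X + α * coeff n (expand p hp.ne_zero l) := by
      rw [hln]
      field_simp
    linear_combination this
  rw [hfin]
  exact sub_mem (sub_mem hX (mul_mem (coe_mem α) hz)) hG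

end Integral

/-! ### The p-typical logarithm of height one. -/

section Log

variable {p : ℕ} [Fact p.Prime]

/-- The logarithm `∑ α^k X^(p^k) / p^k`. -/
def typicalLog (α : ℤ_[p]) : ℚ_[p]⟦X⟧ :=
  PowerSeries.mk fun n => if n = p ^ Nat.log p n then ((α : ℚ_[p]) / p) ^ Nat.log p n else 0

variable (α : ℤ_[p])

lemma coeff_typicalLog_mul (m : ℕ) :
    coeff (p * m) (typicalLog α) = α / p * coeff m (typicalLog α) := by
  have hp : p.Prime := Fact.out
  rw [typicalLog, coeff_mk, coeff_mk]
  rcases Nat.eq_zero_or_pos m with rfl | hm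
  · simp
  · rw [mul_comm p m, Nat.log_mul_base hp.one_lt hm.ne', pow_succ, pow_succ, mul_ite, mul_zero]
    have : m * p = p ^ Nat.log p m * p ↔ m = p ^ Nat.log p m := Nat.mul_left_inj hp.ne_zero
    simp only [this]
    congr 1
    ring

/-- As p^k ≡ 1 mod p - 1, the logarithm is X times a series in X^(p-1); it therefore respects the
grading by exponents modulo p - 1. -/
lemma coeff_typicalLog_eq_zero {m : ℕ} (h : ¬ m ≡ 1 [MOD p - 1]) : coeff m (typicalLog α) = 0 := by
  have hp : p.Prime := Fact.out
  rw [typicalLog, coeff_mk, if_neg]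
  intro hm
  apply h
  have h1 : p ≡ 1 [MOD p - 1] := ((Nat.modEq_iff_dvd' hp.one_lt.le).2 dvd_rfl).symm
  have := h1.pow (Nat.log p m)
  rwa [one_pow, ← hm] at this

lemma typicalLog_eq : typicalLog α =
    X + C ((α : ℚ_[p]) / p) * expand p (Fact.out : p.Prime).ne_zero (typicalLog α) := by
  have hp : p.Prime := Fact.out
  ext n
  rw [map_add, coeff_C_mul, coeff_expand, coeff_X]
  split_ifs with h1 h2 h2
  · exact absurd (Nat.dvd_one.1 (h1 ▸ h2)) hp.one_lt.ne'
  · rw [h1, typicalLog, coeff_mk]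
    simp
  · obtain ⟨m, rfl⟩ := h2
    rw [coeff_typicalLog_mul, Nat.mul_div_cancel_left _ hp.pos, zero_add]
  · rw [typicalLog, coeff_mk, if_neg]
    · simp
    · intro hn
      rcases hk : Nat.log p n with _ | k
      · rw [hk, pow_zero] at hn
        exact h1 hn
      · rw [hk, pow_succ] at hn
        exact h2 ⟨_, hn.trans (mul_comm _ _)⟩

lemma natCast_mul_coeff_typicalLog (m : ℕ) :
    (m : ℚ_[p]) * coeff m (typicalLog α) ∈ PadicInt.subring p := by
  have hp : p.Prime := Fact.out
  rw [typicalLog, coeff_mk]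
  split_ifs with h
  · have : (m : ℚ_[p]) * ((α : ℚ_[p]) / p) ^ Nat.log p m = α ^ Nat.log p m := by
      have h1 : (m : ℚ_[p]) = (p : ℚ_[p]) ^ Nat.log p m := by exact_mod_cast h
      have hp0 : (p : ℚ_[p]) ≠ 0 := Nat.cast_ne_zero.2 hp.ne_zero
      rw [h1, div_pow]
      field_simp
    rw [this]
    exact pow_mem (coe_mem α) _
  · rw [mul_zero]
    exact zero_mem _

lemma coeff_zero_typicalLog : coeff 0 (typicalLog α) = 0 := by
  rw [typicalLog, coeff_mk]
  simp

lemma coeff_one_typicalLog : coeff 1 (typicalLog α) = 1 := by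
  rw [typicalLog, coeff_mk]
  simp

end Log

end CurveExpansion

end

noncomputable section

namespace CurveExpansion

open PowerSeries

/-! ### Grading power series by exponents modulo `M`. -/

section Projection

variable {R : Type*} [CommRing R]

/-- The part of a power series with exponents congruent to `N` modulo `M`. -/
def proj (M N : ℕ) (f : R⟦X⟧) : R⟦X⟧ := PowerSeries.mk fun n => if n ≡ N [MOD M] then coeff n f else 0

lemma coeff_proj (M N n : ℕ) (f : R⟦X⟧) :
    coeff n (proj M N f) = if n ≡ N [MOD M] then coeff n f else 0 := coeff_mk _ _

lemma proj_mul {M N : ℕ} {g : R⟦X⟧} (hg : ∀ n, ¬ n ≡ 0 [MOD M] → coeff n g = 0) (f : R⟦X⟧) :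
    proj M N (g * f) = g * proj M N f := by
  ext n
  have key : ∀ x ∈ Finset.HasAntidiagonal.antidiagonal n, coeff x.1 g * coeff x.2 (proj M N f) =
      if n ≡ N [MOD M] then coeff x.1 g * coeff x.2 f else 0 := by
    intro x hx
    rw [Finset.HasAntidiagonal.mem_antidiagonal] at hx
    by_cases h0 : x.1 ≡ 0 [MOD M]
    · have : n ≡ x.2 [MOD M] := by simpa [hx] using h0.add_right x.2
      have h : n ≡ N [MOD M] ↔ x.2 ≡ N [MOD M] := ⟨this.symm.trans, this.trans⟩
      rw [coeff_proj, mul_ite, mul_zero]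
      simp only [h]
    · simp [hg _ h0]
  rw [coeff_proj, coeff_mul, coeff_mul, Finset.sum_congr rfl key]
  split_ifs
  · rfl
  · rw [Finset.sum_const_zero]

lemma proj_pow_mul {M N : ℕ} {g : R⟦X⟧} (hg : ∀ n, ¬ n ≡ 0 [MOD M] → coeff n g = 0) (e : ℕ)
    (f : R⟦X⟧) : proj M N (g ^ e * f) = g ^ e * proj M N f := by
  induction e with
  | zero => simp
  | succ e ih => rw [pow_succ', mul_assoc, proj_mul hg, ih, mul_assoc]

lemma coeff_pow_eq_zero_of_proj {M : ℕ} {g : R⟦X⟧} (hg : ∀ n, ¬ n ≡ 0 [MOD M] → coeff n g = 0)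
    (e n : ℕ) (hn : ¬ n ≡ 0 [MOD M]) : coeff n (g ^ e) = 0 := by
  have h1 : proj M 0 (1 : R⟦X⟧) = 1 := by
    ext n
    rw [coeff_proj, coeff_one]
    split_ifs with h h' h'
    · rfl
    · rfl
    · exact absurd (by rw [h']) h
    · rfl
  have := proj_pow_mul (N := 0) hg e 1
  rw [h1, mul_one] at this
  rw [← this, coeff_proj, if_neg hn]

/-- The series (X g)^m only involves exponents congruent to m modulo M. -/
lemma proj_subst {M : ℕ} {g : R⟦X⟧} (hg : ∀ n, ¬ n ≡ 0 [MOD M] → coeff n g = 0) (N : ℕ)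
    (f : R⟦X⟧) : proj M N (f.subst (X * g)) = (proj M N f).subst (X * g) := by
  have h0 : constantCoeff (X * g) = 0 := by simp
  ext n
  rw [coeff_proj, coeff_subst_eq_sum h0, coeff_subst_eq_sum h0]
  have key : ∀ m, coeff n ((X * g) ^ m) ≠ 0 → n ≡ m [MOD M] := by
    intro m hm
    rw [mul_pow, coeff_X_pow_mul'] at hm
    split_ifs at hm with h
    · by_contra hnm
      refine hm (coeff_pow_eq_zero_of_proj hg m _ fun h' => hnm ?_)
      have := h'.add_right m
      rwa [Nat.sub_add_cancel h, zero_add] at this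
    · exact absurd rfl hm
  split_ifs with h
  · refine Finset.sum_congr rfl fun m _ => ?_
    by_cases hm : coeff n ((X * g) ^ m) = 0
    · rw [hm, mul_zero, mul_zero]
    · rw [coeff_proj, if_pos ((key m hm).symm.trans h)]
  · symm
    refine Finset.sum_eq_zero fun m _ => ?_
    by_cases hm : coeff n ((X * g) ^ m) = 0
    · rw [hm, mul_zero]
    · rw [coeff_proj, if_neg fun h' => h ((key m hm).trans h'), zero_mul]

end Projection

/-! ### The derivation d/du and Kummer sums. -/

section Derivation

variable {R : Type*} [CommRing R]

lemma derivative_map {S : Type*} [CommRing S] (φ : R →+* S) (f : R⟦X⟧) :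
    d⁄dX S (PowerSeries.map φ f) = PowerSeries.map φ (d⁄dX R f) := by
  ext n
  simp [coeff_derivative]

lemma map_iterate_der {S : Type*} [CommRing S] (φ : R →+* S) (g f : R⟦X⟧) (m : ℕ) :
    PowerSeries.map φ ((der g)^[m] f) = (der (PowerSeries.map φ g))^[m] (PowerSeries.map φ f) := by
  induction m with
  | zero => rfl
  | succ m ih =>
    rw [Function.iterate_succ_apply', Function.iterate_succ_apply', ← ih, der_apply, der_apply,
      derivative_map, map_mul]

/-- With u = l, the derivation `der g` is d/du; this is the chain rule. -/
lemma iterate_der_subst {g l : R⟦X⟧} (hl : constantCoeff l = 0) (hgl : g * d⁄dX R l = 1) (m : ℕ)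
    (f : R⟦X⟧) : (der g)^[m] (f.subst l) = ((d⁄dX R)^[m] f).subst l := by
  induction m with
  | zero => rfl
  | succ m ih =>
    rw [Function.iterate_succ_apply', ih, Function.iterate_succ_apply', der_apply,
      derivative_subst (HasSubst.of_constantCoeff_zero' hl)]
    linear_combination ((d⁄dX R ((d⁄dX R)^[m] f)).subst l) * hgl

lemma constantCoeff_subst_eq {l : R⟦X⟧} (hl : constantCoeff l = 0) (f : R⟦X⟧) :
    constantCoeff (f.subst l) = constantCoeff f := by
  have := coeff_subst_eq_sum hl f 0
  simpa using this

lemma constantCoeff_iterate_der_subst {g l : R⟦X⟧} (hl : constantCoeff l = 0)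
    (hgl : g * d⁄dX R l = 1) (m : ℕ) (f : R⟦X⟧) :
    constantCoeff ((der g)^[m] (f.subst l)) = m.factorial * coeff m f := by
  rw [iterate_der_subst hl hgl, constantCoeff_subst_eq hl, constantCoeff_iterate_derivative]

end Derivation

section Congruence

variable {R : Type*} [CommRing R]

lemma pow_dvd_of_forall_dvd {A : Type*} [AddCommGroup A] [Module R A] (T : Module.End R A) (c : R)
    (hT : ∀ f, ∃ k, T f = c • k) (a : ℕ) (f : A) : ∃ k, (T ^ a) f = c ^ a • k := by
  induction a with
  | zero => exact ⟨f, by simp⟩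
  | succ a ih =>
    obtain ⟨k, hk⟩ := ih
    obtain ⟨k', hk'⟩ := hT k
    exact ⟨k', by rw [pow_succ', Module.End.mul_apply, hk, map_smul, hk', smul_smul, ← pow_succ]⟩

/-- If `D^p ≡ A D` modulo `c`, then the Kummer sums of iterates of `D` are divisible by `c^a`. -/
lemma kummer_sum {A : Type*} [AddCommGroup A] [Module R A] (D : Module.End R A) (c b : R) {p : ℕ}
    (hp : 0 < p) (hD : ∀ f, ∃ k, (D ^ p) f - b • D f = c • k) {a N : ℕ} (haN : a ≤ N) (f : A) :
    ∃ k, ∑ r ∈ Finset.range (a + 1),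
      ((-1) ^ r * (a.choose r : R) * b ^ (a - r)) • (D ^ (N + r * (p - 1))) f = c ^ a • k := by
  -- Binomial expansion: the r-th term has exponent (N - a) + pr + (a - r) = N + r(p - 1). The spare
  -- factor D^(N-a) is where a ≤ N enters.
  have hpoly : (Polynomial.X : Polynomial R) ^ (N - a) *
      (-Polynomial.X ^ p + Polynomial.C b * Polynomial.X) ^ a =
      ∑ r ∈ Finset.range (a + 1), Polynomial.C ((-1) ^ r * (a.choose r : R) * b ^ (a - r)) *
        Polynomial.X ^ (N + r * (p - 1)) := by
    rw [add_pow, Finset.mul_sum]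
    refine Finset.sum_congr rfl fun r hr => ?_
    rw [Finset.mem_range] at hr
    obtain ⟨q, rfl⟩ : ∃ q, p = q + 1 := ⟨p - 1, by omega⟩
    obtain ⟨s, rfl⟩ : ∃ s, a = r + s := ⟨a - r, by omega⟩
    obtain ⟨t, rfl⟩ := Nat.exists_eq_add_of_le haN
    simp only [Nat.add_sub_cancel_left, Nat.add_sub_cancel, map_mul, map_pow, map_neg, map_one,
      map_natCast]
    rw [neg_pow ((Polynomial.X : Polynomial R) ^ (q + 1)) r]
    ring
  have h := congrArg (fun P => Polynomial.aeval D P f) hpoly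
  simp only [map_mul (Polynomial.aeval D), map_pow (Polynomial.aeval D), map_add, map_neg,
    Polynomial.aeval_X, Polynomial.aeval_C, map_sum, LinearMap.sum_apply, Module.End.mul_apply,
    Module.algebraMap_end_apply] at h
  obtain ⟨k, hk⟩ := pow_dvd_of_forall_dvd (-D ^ p + algebraMap R (Module.End R A) b * D) c
    (fun f => by
      obtain ⟨k, hk⟩ := hD f
      refine ⟨-k, ?_⟩
      rw [smul_neg, ← hk]
      simp [Module.algebraMap_end_apply, sub_eq_add_neg, add_comm]) a f
  exact ⟨(D ^ (N - a)) k, by rw [← map_smul, ← hk, h]⟩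

end Congruence

/-! ### Kummer congruences in the presence of a pole. -/

section Main

variable {p : ℕ} [Fact p.Prime]

/-- Here h ds = du for u = `typicalLog α`, so h = ∑ α^k s^(p^k - 1) satisfies the Cartier eigenvalue
relation exactly, not only modulo p; g d/ds is d/du. -/
lemma exists_dual (α : ℤ_[p]) : ∃ g h : ℤ_[p]⟦X⟧, g * h = 1 ∧
    PowerSeries.map (algebraMap ℤ_[p] ℚ_[p]) h = d⁄dX ℚ_[p] (typicalLog α) ∧
    ∀ f, ∃ k, (der g)^[p] f - α • der g f = (p : ℤ_[p]) • k := by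
  have hp : p.Prime := Fact.out
  have hh : d⁄dX ℚ_[p] (typicalLog α) ∈ integral p := by
    rw [mem_integral]
    intro n
    rw [coeff_derivative, mul_comm]
    exact_mod_cast natCast_mul_coeff_typicalLog α (n + 1)
  obtain ⟨h, hh⟩ := hh
  have hcoeff : ∀ n, ((coeff n h : ℤ_[p]) : ℚ_[p]) = coeff (n + 1) (typicalLog α) * (n + 1) := by
    intro n
    rw [← coeff_derivative, ← hh, coeff_map]
    rfl
  have h0 : constantCoeff h = 1 := by
    have := hcoeff 0
    rw [zero_add, coeff_one_typicalLog] at this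
    rw [← coeff_zero_eq_constantCoeff_apply]
    apply PadicInt.ext
    simpa using this
  obtain ⟨g, hg⟩ := isUnit_iff_exists_inv'.1 (isUnit_iff_constantCoeff.2 (h0 ▸ isUnit_one))
  refine ⟨g, h, hg, hh, fun f => ?_⟩
  have hfrob : ∀ m, coeff (p * m + (p - 1)) h = α * coeff m h := by
    intro m
    apply PadicInt.ext
    rw [PadicInt.coe_mul, hcoeff, hcoeff]
    have e : p * m + (p - 1) + 1 = p * (m + 1) := by
      have := hp.pos
      rw [mul_add, mul_one]
      omega
    have e' : (((p * m + (p - 1) : ℕ) : ℚ_[p]) + 1) = p * (m + 1) := by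
      exact_mod_cast congrArg (Nat.cast : ℕ → ℚ_[p]) e
    have hp0 : (p : ℚ_[p]) ≠ 0 := Nat.cast_ne_zero.2 hp.ne_zero
    rw [e, e', coeff_typicalLog_mul]
    field_simp
  have := iterate_der_prime (p := p) (g := PowerSeries.map PadicInt.toZMod g)
    (h := PowerSeries.map PadicInt.toZMod h) (by rw [← map_mul, hg, map_one]) (PadicInt.toZMod α)
    (fun m => by rw [coeff_map, coeff_map, hfrob, map_mul]) (PowerSeries.map PadicInt.toZMod f)
  rw [← map_iterate_der, show der (PowerSeries.map PadicInt.toZMod g)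
    (PowerSeries.map PadicInt.toZMod f) = PowerSeries.map PadicInt.toZMod (der g f) from
      (map_iterate_der PadicInt.toZMod g f 1).symm, ← map_C, ← map_mul, ← sub_eq_zero, ← map_sub,
    map_toZMod_eq_zero_iff] at this
  obtain ⟨k, hk⟩ := this
  refine ⟨k, ?_⟩
  rw [smul_eq_C_mul, hk, smul_eq_C_mul, map_natCast]

/-- The congruences for the coefficients of a power series in `u` that becomes integral, up to a
pole of order `e`, in terms of the parameter with logarithm `typicalLog α`. -/
theorem kummer_congruence {α A : ℤ_[p]} (hA : (p : ℤ_[p]) ∣ A - α) {R Z : ℚ_[p]⟦X⟧} {a e N : ℕ}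
    (haN : a ≤ N) (hZ : Z ∈ integral p)
    (hRZ : X ^ e * R.subst (typicalLog α) = Z * typicalLog α ^ e)
    (hN : ∀ j < e, ¬ j ≡ N + e [MOD p - 1]) :
    ∃ z : ℤ_[p], ∑ r ∈ Finset.range (a + 1), (-1 : ℚ_[p]) ^ r * (a.choose r : ℚ_[p]) *
      (A : ℚ_[p]) ^ (a - r) * (((N + r * (p - 1)).factorial : ℚ_[p]) *
        coeff (N + r * (p - 1) + e) R) = (p : ℚ_[p]) ^ a * z := by
  have hp : p.Prime := Fact.out
  obtain ⟨l, hl, hl0⟩ : ∃ l : ℚ_[p]⟦X⟧, typicalLog α = X * l ∧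
      ∀ n, ¬ n ≡ 0 [MOD p - 1] → coeff n l = 0 := by
    obtain ⟨l, hl⟩ := X_dvd_iff.2 ((coeff_zero_eq_constantCoeff_apply _).symm.trans
      (coeff_zero_typicalLog α))
    refine ⟨l, hl, fun n hn => ?_⟩
    have := coeff_typicalLog_eq_zero α (m := n + 1) fun h => hn (Nat.ModEq.add_right_cancel' 1 h)
    rwa [hl, coeff_succ_X_mul] at this
  have hX : (X : ℚ_[p]⟦X⟧) ^ e ≠ 0 := pow_ne_zero _ X_ne_zero
  have hlog0 : constantCoeff (typicalLog α) = 0 := by rw [hl]; simp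
  have hl1 : l ^ e ≠ 0 := by
    refine pow_ne_zero _ fun h => ?_
    have := coeff_one_typicalLog α
    rw [hl, h, mul_zero, map_zero] at this
    exact zero_ne_one this
  have hR : R.subst (typicalLog α) = l ^ e * Z := by
    apply mul_left_cancel₀ hX
    rw [hRZ, hl, mul_pow]
    ring
  -- Only coefficients of index N + e + r(p-1) enter the sum, so R may be replaced by its projection
  -- to that residue class, where `hN` excludes the polar terms.
  obtain ⟨y, hy⟩ : X ^ e ∣ proj (p - 1) (N + e) R := by
    rw [X_pow_dvd_iff]
    intro j hj
    rw [coeff_proj, if_neg (hN j hj)]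
  have hys : X ^ e * y.subst (typicalLog α) = proj (p - 1) (N + e) Z := by
    apply mul_left_cancel₀ hl1
    have hs := HasSubst.of_constantCoeff_zero' hlog0
    rw [← proj_pow_mul hl0, ← hR, hl, proj_subst hl0, ← hl, hy, subst_mul hs, subst_pow hs,
      subst_X hs, hl, mul_pow]
    ring
  have hyi : y.subst (typicalLog α) ∈ integral p := by
    rw [mem_integral]
    intro n
    have := congrArg (coeff (n + e)) hys
    rw [coeff_X_pow_mul, coeff_proj] at this
    rw [this]
    split_ifs
    · exact mem_integral.1 hZ _
    · exact zero_mem _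
  obtain ⟨f, hf⟩ := hyi
  obtain ⟨g, h, hgh, hh, hg⟩ := exists_dual α
  have hg' : ∀ f, ∃ k, (((der g : ℤ_[p]⟦X⟧ →ₗ[ℤ_[p]] ℤ_[p]⟦X⟧) ^ p : Module.End ℤ_[p] ℤ_[p]⟦X⟧)) f -
      A • (der g : ℤ_[p]⟦X⟧ →ₗ[ℤ_[p]] ℤ_[p]⟦X⟧) f = (p : ℤ_[p]) • k := by
    intro f
    obtain ⟨k, hk⟩ := hg f
    obtain ⟨d, hd⟩ := hA
    refine ⟨k - d • der g f, ?_⟩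
    rw [smul_sub, ← hk, smul_smul, ← hd, sub_smul, Module.End.pow_apply]
    simp
  obtain ⟨k, hk⟩ := kummer_sum _ _ _ hp.pos hg' haN f
  refine ⟨constantCoeff k, ?_⟩
  have h2 := congrArg (fun F => algebraMap ℤ_[p] ℚ_[p] (constantCoeff F)) hk
  simp only [map_sum, smul_eq_C_mul, map_mul, constantCoeff_C, Module.End.pow_apply] at h2
  have hgl : PowerSeries.map (algebraMap ℤ_[p] ℚ_[p]) g * d⁄dX ℚ_[p] (typicalLog α) = 1 := by
    rw [← hh, ← map_mul, hgh, map_one]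
  have h3 : ∀ m, m ≡ N [MOD p - 1] → algebraMap ℤ_[p] ℚ_[p] (constantCoeff ((der g)^[m] f)) =
      m.factorial * coeff (m + e) R := by
    intro m hm
    rw [← coeff_zero_eq_constantCoeff_apply, ← coeff_map, coeff_zero_eq_constantCoeff_apply,
      map_iterate_der, hf, constantCoeff_iterate_der_subst hlog0 hgl]
    have := congrArg (coeff (m + e)) hy
    rw [coeff_proj, if_pos (hm.add_right e), coeff_X_pow_mul] at this
    rw [this]
  have h4 : algebraMap ℤ_[p] ℚ_[p] ((p : ℤ_[p]) ^ a) = (p : ℚ_[p]) ^ a := by simp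
  rw [h4] at h2
  refine Eq.trans (Finset.sum_congr rfl fun r _ => ?_) h2
  have h5 := h3 (N + r * (p - 1)) (by simp [Nat.ModEq])
  simp only [map_pow, map_neg, map_one, map_natCast]
  rw [← h5]
  rfl

end Main

end CurveExpansion

end

noncomputable section

namespace CurveExpansion

open PowerSeries

lemma coe_ofNat {p : ℕ} [Fact p.Prime] (n : ℕ) [n.AtLeastTwo] :
    ((OfNat.ofNat n : ℤ_[p]) : ℚ_[p]) = OfNat.ofNat n :=
  map_ofNat (PadicInt.Coe.ringHom (p := p)) n

/-! ### The curve in the parameter t = x^(-1/2). -/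

section Curve

variable (p : ℕ) [Fact p.Prime]

/-- The power series `(1 - X^10)^(-1/2)`. -/
def invSqrtSeries : ℚ_[p]⟦X⟧ :=
  expand 10 (by norm_num) (PowerSeries.mk fun k => (invSqrtCoeff p k : ℚ_[p]))

/-- The integral of `(1 - X^10)^(-1/2)`, that is, `u` as a function of the parameter `x^(-1/2)`. -/
def curveLog : ℚ_[p]⟦X⟧ := PowerSeries.mk fun n => coeff n (X * invSqrtSeries p) / n

/-- The power series `G` with `X^(-3) G` an integral of `X^(-4) (1 - X^10)^(-1/2)`. -/
def secondKind : ℚ_[p]⟦X⟧ :=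
  expand 10 (by norm_num) (PowerSeries.mk fun k => (invSqrtCoeff p k : ℚ_[p]) / (10 * k - 3))

variable {p}

lemma coeff_invSqrtSeries (n : ℕ) :
    coeff n (invSqrtSeries p) = if 10 ∣ n then (invSqrtCoeff p (n / 10) : ℚ_[p]) else 0 := by
  rw [invSqrtSeries, coeff_expand, coeff_mk]

lemma invSqrtSeries_mem : invSqrtSeries p ∈ integral p := by
  rw [mem_integral]
  intro n
  rw [coeff_invSqrtSeries]
  split_ifs
  · exact coe_mem _
  · exact zero_mem _

lemma natCast_mul_coeff_curveLog (n : ℕ) :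
    (n : ℚ_[p]) * coeff n (curveLog p) = coeff n (X * invSqrtSeries p) := by
  rw [curveLog, coeff_mk]
  rcases Nat.eq_zero_or_pos n with rfl | hn
  · simp
  · have : (n : ℚ_[p]) ≠ 0 := Nat.cast_ne_zero.2 hn.ne'
    field_simp

lemma derivative_curveLog : d⁄dX ℚ_[p] (curveLog p) = invSqrtSeries p := by
  ext n
  have := natCast_mul_coeff_curveLog (p := p) (n + 1)
  rw [coeff_succ_X_mul] at this
  rw [coeff_derivative, ← this]
  push_cast
  ring

lemma coeff_zero_curveLog : coeff 0 (curveLog p) = 0 := by simp [curveLog]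

lemma coeff_one_curveLog : coeff 1 (curveLog p) = 1 := by
  have := natCast_mul_coeff_curveLog (p := p) 1
  rw [show (1 : ℕ) = 0 + 1 by rfl, coeff_succ_X_mul, coeff_invSqrtSeries] at this
  simpa [invSqrtCoeff_zero] using this

variable {q : ℕ} (hq : p = 10 * q + 1)
include hq

lemma invSqrtSeries_sq : invSqrtSeries p ^ 2 * (1 - X ^ 10) = 1 := by
  set S : ℚ_[p]⟦X⟧ := PowerSeries.mk fun k => (invSqrtCoeff p k : ℚ_[p]) with hS
  have h1 : 2 * (1 - X) * d⁄dX ℚ_[p] S = S := by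
    ext n
    have e : 2 * (1 - X) * d⁄dX ℚ_[p] S = C 2 * (d⁄dX ℚ_[p] S - X * d⁄dX ℚ_[p] S) := by
      rw [map_ofNat C 2]
      ring
    rw [e, coeff_C_mul, map_sub]
    have h2 : ∀ k : ℕ, (2 * (k : ℚ_[p]) + 2) * coeff (k + 1) S = (2 * k + 1) * coeff k S := by
      intro k
      rw [hS, coeff_mk, coeff_mk]
      have := congrArg (fun x : ℤ_[p] => (x : ℚ_[p])) (invSqrtCoeff_succ hq k)
      have h2 : ((2 : ℤ_[p]) : ℚ_[p]) = 2 := coe_ofNat 2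
      push_cast at this
      rw [h2] at this
      exact this
    rcases n with _ | n
    · have := h2 0
      rw [coeff_derivative, coeff_zero_X_mul]
      push_cast at this ⊢
      linear_combination this
    · have := h2 (n + 1)
      rw [coeff_succ_X_mul, coeff_derivative, coeff_derivative]
      push_cast at this ⊢
      linear_combination this
  have h3 : S ^ 2 * (1 - X) = 1 := by
    apply derivative.ext
    · rw [Derivation.leibniz, derivative_pow, map_sub, derivative_one, derivative_X]
      simp only [smul_eq_mul]
      push_cast
      linear_combination S * h1
    · have : constantCoeff S = 1 := by
        rw [← coeff_zero_eq_constantCoeff_apply, hS, coeff_mk, invSqrtCoeff_zero, PadicInt.coe_one]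
      simp [this]
  have := congrArg (expand 10 (by norm_num)) h3
  simpa [invSqrtSeries] using this

/-- Nonzero coefficients sit at the indices 10k + 1, and p(10k + 1) = 10(kp + q) + 1. At such an
index the difference has denominator p(10k + 1), exactly the modulus in `hα`. At indices prime to p
there is nothing to cancel. -/
lemma curveLog_sub_mem {α : ℤ_[p]} (hα : ∀ k, (p : ℤ_[p]) * ((10 * k + 1 : ℕ) : ℤ_[p]) ∣
    invSqrtCoeff p (k * p + q) - α * invSqrtCoeff p k) :
    curveLog p - C ((α : ℚ_[p]) / p) * expand p (Fact.out : p.Prime).ne_zero (curveLog p) ∈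
      integral p := by
  have hp : p.Prime := Fact.out
  have hp0 : (p : ℚ_[p]) ≠ 0 := Nat.cast_ne_zero.2 hp.ne_zero
  rw [mem_integral]
  intro n
  rw [map_sub, coeff_C_mul, coeff_expand]
  split_ifs with h
  · obtain ⟨m, rfl⟩ := h
    rw [Nat.mul_div_cancel_left _ hp.pos]
    rcases m with _ | m
    · rw [mul_zero, coeff_zero_curveLog]
      simp
    have hm : ((m : ℚ_[p]) + 1) ≠ 0 := by exact_mod_cast Nat.succ_ne_zero m
    have e1 := natCast_mul_coeff_curveLog (p := p) (m + 1)
    have e2 := natCast_mul_coeff_curveLog (p := p) (p * (m + 1))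
    rw [coeff_succ_X_mul, coeff_invSqrtSeries] at e1
    rw [show p * (m + 1) = (p * m + 10 * q) + 1 by rw [mul_add, mul_one]; omega,
      coeff_succ_X_mul, coeff_invSqrtSeries, show (p * m + 10 * q) + 1 = p * (m + 1) by
        rw [mul_add, mul_one]; omega] at e2
    have hiff : 10 ∣ p * m + 10 * q ↔ 10 ∣ m := by
      rw [hq, show (10 * q + 1) * m + 10 * q = 10 * (q * m + q) + m by ring]
      omega
    simp only [hiff] at e2
    push_cast at e1 e2
    have e3 : coeff (p * (m + 1)) (curveLog p) - α / p * coeff (m + 1) (curveLog p) =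
        (p * (m + 1) * coeff (p * (m + 1)) (curveLog p) -
          α * ((m + 1) * coeff (m + 1) (curveLog p))) / (p * (m + 1)) := by
      field_simp
    rw [e3, e1, e2]
    split_ifs with h10
    · obtain ⟨k, rfl⟩ := h10
      obtain ⟨z, hz⟩ := hα k
      rw [show (p * (10 * k) + 10 * q) = 10 * (k * p + q) by ring,
        Nat.mul_div_cancel_left _ (by norm_num), Nat.mul_div_cancel_left _ (by norm_num)]
      have hz' := congrArg (fun x : ℤ_[p] => (x : ℚ_[p])) hz
      push_cast at hz' hm ⊢
      rw [coe_ofNat] at hz'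
      rw [hz', mul_div_cancel_left₀ _ (mul_ne_zero hp0 hm)]
      exact coe_mem z
    · simp
  · rw [mul_zero, sub_zero]
    have hu := isUnit_natCast h
    have hn : (n : ℚ_[p]) ≠ 0 := by
      rw [Nat.cast_ne_zero]
      rintro rfl
      exact h (dvd_zero p)
    have e : coeff n (curveLog p) =
        (Ring.inverse (n : ℤ_[p]) : ℤ_[p]) * coeff n (X * invSqrtSeries p) := by
      rw [← natCast_mul_coeff_curveLog, ← mul_assoc]
      have := congrArg (fun x : ℤ_[p] => (x : ℚ_[p])) (Ring.inverse_mul_cancel _ hu)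
      push_cast at this
      rw [this, one_mul]
    rw [e]
    refine mul_mem (coe_mem _) ?_
    rcases n with _ | n
    · simp
    · rw [coeff_succ_X_mul]
      exact mem_integral.1 invSqrtSeries_mem n

lemma secondKind_mem : secondKind p ∈ integral p := by
  rw [mem_integral]
  intro n
  rw [secondKind, coeff_expand, coeff_mk]
  split_ifs
  · generalize n / 10 = k
    obtain ⟨z, hz⟩ := dvd_invSqrtCoeff hq k
    have hne : (10 * (k : ℚ_[p]) - 3) ≠ 0 := by
      have : ((10 * (k : ℤ) - 3 : ℤ) : ℚ_[p]) ≠ 0 := Int.cast_ne_zero.2 (by omega)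
      exact_mod_cast this
    rw [hz]
    push_cast
    rw [coe_ofNat, coe_ofNat]
    rw [mul_div_cancel_left₀ _ hne]
    exact coe_mem z
  · exact zero_mem _

omit hq in
lemma X_mul_derivative_secondKind :
    X * d⁄dX ℚ_[p] (secondKind p) - 3 * secondKind p = invSqrtSeries p := by
  ext n
  have e : coeff n (X * d⁄dX ℚ_[p] (secondKind p)) = n * coeff n (secondKind p) := by
    rcases n with _ | n
    · simp
    · rw [coeff_succ_X_mul, coeff_derivative]
      push_cast
      ring
  rw [map_sub, e, ← map_ofNat C 3, coeff_C_mul, coeff_invSqrtSeries, secondKind,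
    coeff_expand, coeff_mk]
  split_ifs with h
  · obtain ⟨k, rfl⟩ := h
    rw [Nat.mul_div_cancel_left _ (by norm_num)]
    have hne : (10 * (k : ℚ_[p]) - 3) ≠ 0 := by
      have : ((10 * (k : ℤ) - 3 : ℤ) : ℚ_[p]) ≠ 0 := Int.cast_ne_zero.2 (by omega)
      exact_mod_cast this
    push_cast
    field_simp
  · ring

/-- The series τ is t expanded in s: the inverse of `curveLog` composed with `typicalLog α`. The two
logarithms obey functional equations with the same α. -/
lemma exists_parameter : ∃ (α : ℤ_[p]) (τ : ℚ_[p]⟦X⟧),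
    (p : ℤ_[p]) ∣ (CurveInversion.hasseA p : ℤ_[p]) - α ∧ constantCoeff τ = 0 ∧ coeff 1 τ = 1 ∧
      τ ∈ integral p ∧ (curveLog p).subst τ = typicalLog α := by
  obtain ⟨α, hα⟩ := exists_unitRoot hq
  have hU0 : constantCoeff (curveLog p) = 0 := by
    rw [← coeff_zero_eq_constantCoeff_apply, coeff_zero_curveLog]
  have hl0 : constantCoeff (typicalLog α) = 0 := by
    rw [← coeff_zero_eq_constantCoeff_apply, coeff_zero_typicalLog]
  have hU1 : IsUnit (coeff 1 (curveLog p)) := by rw [coeff_one_curveLog]; exact isUnit_one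
  have hVs := HasSubst.substInvOfIsUnit (curveLog p) hU1
  have hls := HasSubst.of_constantCoeff_zero' hl0
  set τ := ((curveLog p).substInvOfIsUnit hU1).subst (typicalLog α) with hτd
  have hτ : (curveLog p).subst τ = typicalLog α := by
    rw [hτd, ← subst_comp_subst_apply hVs hls, subst_substInvOfIsUnit_right _ hU0, subst_X hls]
  have hτ0 : constantCoeff τ = 0 := by
    rw [hτd, constantCoeff_subst_eq hl0, constantCoeff_substInvOfIsUnit]
  refine ⟨α, τ, ?_, hτ0, ?_, ?_, hτ⟩
  · have h1 := hα 0
    simp only [zero_mul, zero_add, mul_zero, Nat.cast_one, mul_one, invSqrtCoeff_zero] at h1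
    have := dvd_add (hasseA_congr hq) h1
    rwa [sub_add_sub_cancel] at this
  · have := congrArg (coeff 1) hτ
    rw [coeff_subst_eq_sum hτ0, coeff_one_typicalLog] at this
    simpa [Finset.sum_range_succ, coeff_one_curveLog, coeff_zero_curveLog] using this
  · refine integral_of_subst_eq coeff_zero_curveLog coeff_one_curveLog (fun m => ?_)
      (curveLog_sub_mem hq hα) (typicalLog_eq α) hτ0 hτ
    rw [natCast_mul_coeff_curveLog]
    exact mem_integral.1 (mul_mem ⟨X, by simp⟩ invSqrtSeries_mem) m

end Curve

/-! ### Uniqueness for the differential equation of 1/x. -/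

section DifferentialEquation

variable {k : Type*} [Field k] [CharZero k]

/-- Uniqueness for `D² z = 2 - 12 z⁵`. -/
lemma ode_unique {g v w : k⟦X⟧} (hg : constantCoeff g ≠ 0) (hv : X ^ 2 ∣ v) (hw : X ^ 2 ∣ w)
    (hv' : der g (der g v) = 2 - 12 * v ^ 5) (hw' : der g (der g w) = 2 - 12 * w ^ 5) : v = w := by
  rw [← sub_eq_zero]
  have hdvd : ∀ n, X ^ (n + 2) ∣ v - w := by
    intro n
    induction n with
    | zero => exact dvd_sub hv hw
    | succ n ih =>
      obtain ⟨f, hf⟩ := ih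
      have h1 : der g (der g (v - w)) = -12 * (v ^ 5 - w ^ 5) := by
        rw [map_sub, map_sub, hv', hw']
        ring
      have h2 : X ^ (n + 2) ∣ der g (der g (v - w)) := by
        rw [h1]
        exact ((Dvd.intro _ hf.symm).trans (sub_dvd_pow_sub_pow v w 5)).mul_left _
      -- If v - w = X^(n+2) f, the leading term of D²(v - w) is (n+2)(n+1) g² f X^n, while the
      -- equation makes D²(v - w) divisible by X^(n+2). So f(0) = 0.
      have h3 : der g (der g (v - w)) = X ^ n * (g ^ 2 * C ((n + 2) * (n + 1) : k) * f) +
          X ^ (n + 1) * (g * (2 * C ((n + 2 : k)) * g * d⁄dX k f + d⁄dX k g * C ((n + 2 : k)) * f +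
            X * (d⁄dX k g * d⁄dX k f + g * d⁄dX k (d⁄dX k f)))) := by
        rw [hf]
        simp only [der_apply, Derivation.leibniz, derivative_pow, derivative_X, smul_eq_mul,
          map_add, Derivation.map_natCast]
        simp only [map_mul, map_add, map_natCast, map_ofNat, map_one]
        simp only [show n + 2 - 1 = n + 1 by omega, Nat.add_sub_cancel, derivative_one]
        push_cast
        ring
      have h4 := X_pow_dvd_iff.1 h2 n (by omega)
      rw [h3, map_add, X_pow_dvd_iff.1 (Dvd.intro _ rfl) n (Nat.lt_succ_self n), add_zero] at h4
      have h5 := coeff_X_pow_mul (R := k) (g ^ 2 * C ((n + 2) * (n + 1) : k) * f) n 0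
      rw [zero_add] at h5
      rw [h5, coeff_zero_eq_constantCoeff_apply, map_mul, map_mul, map_pow, constantCoeff_C] at h4
      have h6 : constantCoeff f = 0 := by
        have e1 : ((n : k) + 2) ≠ 0 := by exact_mod_cast (Nat.succ_ne_zero (n + 1))
        have e2 : ((n : k) + 1) ≠ 0 := by exact_mod_cast (Nat.succ_ne_zero n)
        exact (mul_eq_zero.1 h4).resolve_left (mul_ne_zero (pow_ne_zero _ hg) (mul_ne_zero e1 e2))
      rw [hf, show n + 1 + 2 = (n + 2) + 1 by ring, pow_succ]
      exact mul_dvd_mul_left _ (X_dvd_iff.2 h6)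
  ext n
  exact X_pow_dvd_iff.1 (hdvd n) n (by omega)

end DifferentialEquation

end CurveExpansion

end

noncomputable section

namespace CurveExpansion

open PowerSeries CurveInversion

/-! ### From the Laurent series x, y to power series. -/

section Expansion

lemma X_coe : ((X : ℚ⟦X⟧) : LaurentSeries ℚ) = HahnSeries.single 1 1 := HahnSeries.ofPowerSeries_X

/-- `u² x(u)` is a power series, inverse to `w / u²` where `w = 1/x`. -/
lemma exists_regular : ∃ R w : ℚ⟦X⟧, R * w = 1 ∧
    d⁄dX ℚ (d⁄dX ℚ (X ^ 2 * w)) = 2 - 12 * (X ^ 2 * w) ^ 5 ∧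
      xSeries * (X : ℚ⟦X⟧) ^ 2 = (R : LaurentSeries ℚ) := by
  obtain ⟨v, hv, h0, h1, hode⟩ := isInversion_series.inv_eq
  obtain ⟨w, rfl⟩ : X ^ 2 ∣ v := by
    rw [X_pow_dvd_iff]
    intro m hm
    interval_cases m
    · exact h0
    · exact h1
  -- The constant term of the equation reads 2 w(0) = 2.
  have hw : constantCoeff w ≠ 0 := by
    have h2 := congrArg (coeff 0) hode
    have e : coeff 0 (2 - 12 * (X ^ 2 * w) ^ 5 : ℚ⟦X⟧) = 2 := by
      simp only [coeff_zero_eq_constantCoeff_apply, map_sub, map_mul, map_pow, constantCoeff_X]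
      rw [map_ofNat constantCoeff 2]
      norm_num
    rw [e, coeff_derivative, coeff_derivative, show (0 + 1 + 1) = 0 + 2 by rfl, add_comm 0 2] at h2
    have e2 := coeff_X_pow_mul w 2 0
    rw [show 0 + 2 = 2 + 0 by rfl] at e2
    rw [e2, coeff_zero_eq_constantCoeff_apply] at h2
    intro h
    rw [h] at h2
    norm_num at h2
  have hx : xSeries ≠ 0 := by
    intro h
    have := isInversion_series.pole
    rw [h] at this
    simp at this
  refine ⟨w⁻¹, w, PowerSeries.inv_mul_cancel w hw, hode, ?_⟩
  have e1 : xSeries * ((X ^ 2 * w : ℚ⟦X⟧) : LaurentSeries ℚ) = 1 := by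
    rw [← hv, mul_inv_cancel₀ hx]
  have e2 : ((w : LaurentSeries ℚ)) * ((w⁻¹ : ℚ⟦X⟧) : LaurentSeries ℚ) = 1 := by
    rw [← map_mul, PowerSeries.mul_inv_cancel w hw, map_one]
  rw [map_mul, map_pow] at e1
  linear_combination ((w⁻¹ : ℚ⟦X⟧) : LaurentSeries ℚ) * e1 - xSeries * (X : ℚ⟦X⟧) ^ 2 * e2

lemma coeff_of_mul_X_pow {f : LaurentSeries ℚ} {g : ℚ⟦X⟧} {k : ℕ}
    (h : f * (X : ℚ⟦X⟧) ^ k = (g : LaurentSeries ℚ)) (m : ℕ) :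
    f.coeff ((m : ℤ) - k) = coeff m g := by
  have e : ((X : ℚ⟦X⟧) : LaurentSeries ℚ) ^ k = HahnSeries.single (k : ℤ) 1 := by
    rw [X_coe, HahnSeries.single_pow]
    simp
  rw [← LaurentSeries.coeff_coe_powerSeries, ← h, e]
  have := HahnSeries.coeff_mul_single_add (x := f) (r := (1 : ℚ)) (a := (m : ℤ) - k) (b := (k : ℤ))
  rw [sub_add_cancel, mul_one] at this
  exact this.symm

lemma genC_div {R : ℚ⟦X⟧} (hR : xSeries * (X : ℚ⟦X⟧) ^ 2 = (R : LaurentSeries ℚ)) {m : ℕ}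
    (hm : m ≠ 0) : genC m / m = (m - 2).factorial * coeff m R := by
  have := coeff_of_mul_X_pow hR m
  rw [genC, ← this]
  have : (m : ℚ) ≠ 0 := Nat.cast_ne_zero.2 hm
  push_cast
  field_simp

/-- Since 4y = 2x dx/du = d(x²)/du, the coefficients of y come from those of x² = R² / u^4. -/
lemma genD_div {R : ℚ⟦X⟧} (hR : xSeries * (X : ℚ⟦X⟧) ^ 2 = (R : LaurentSeries ℚ)) {m : ℕ}
    (hm : 5 ≤ m) : genD m / m = (m - 4).factorial * coeff m (R ^ 2) / 4 := by
  have h1 : xSeries ^ 2 * (X : ℚ⟦X⟧) ^ 4 = ((R ^ 2 : ℚ⟦X⟧) : LaurentSeries ℚ) := by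
    rw [map_pow, ← hR]
    ring
  have h2 := coeff_of_mul_X_pow h1 m
  have h3 : 4 * ySeries = LaurentSeries.derivative ℚ (xSeries ^ 2) := by
    rw [pow_two, CurveInversion.derivative_mul]
    linear_combination (-2) * isInversion_series.differential
  have h4 := congrArg (fun f : LaurentSeries ℚ => f.coeff ((m : ℤ) - 5)) h3
  have e4 : (4 : LaurentSeries ℚ) = HahnSeries.C 4 := (map_ofNat HahnSeries.C 4).symm
  simp only [e4, HahnSeries.C_mul_eq_smul, HahnSeries.coeff_smul, smul_eq_mul, derivative_coeff] at h4
  rw [show (m : ℤ) - 5 + 1 = (m : ℤ) - (4 : ℕ) by push_cast; ring, h2] at h4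
  have hm0 : (m : ℚ) ≠ 0 := Nat.cast_ne_zero.2 (by omega)
  obtain ⟨j, rfl⟩ := Nat.exists_eq_add_of_le hm
  rw [genD, show 5 + j - 4 = j + 1 by omega, show 5 + j - 5 = j by omega, Nat.factorial_succ]
  push_cast at h4 hm0 ⊢
  field_simp
  linear_combination h4

end Expansion

/-! ### Integrality of the expansions, and the theorem. -/

section Congruences

variable {p : ℕ} [Fact p.Prime]

/-- A rational number that is a p-adic integer has denominator prime to p. -/
lemma congrZero_of_eq {a : ℕ} {s : ℚ} {z : ℤ_[p]} (h : (s : ℚ_[p]) = (p : ℚ_[p]) ^ a * z) :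
    CongrZero p a s := by
  have hp : p.Prime := Fact.out
  have hpa : (p : ℚ) ^ a ≠ 0 := pow_ne_zero _ (Nat.cast_ne_zero.2 hp.ne_zero)
  have hpa' : (p : ℚ_[p]) ^ a ≠ 0 := pow_ne_zero _ (Nat.cast_ne_zero.2 hp.ne_zero)
  refine ⟨s / p ^ a, fun hd => ?_, by field_simp⟩
  have hz : ((s / p ^ a : ℚ) : ℚ_[p]) = z := by
    push_cast
    rw [h, mul_div_cancel_left₀ _ hpa']
  have hu := PadicInt.isUnit_den (p := p) (s / p ^ a) (by rw [hz]; exact z.2)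
  rw [PadicInt.isUnit_iff] at hu
  have := (PadicInt.norm_int_lt_one_iff_dvd (p := p) ((s / p ^ a : ℚ).den : ℤ)).2
    (Int.natCast_dvd_natCast.2 hd)
  rw [Int.cast_natCast, hu] at this
  exact lt_irrefl _ this

/-- The expansions in the parameter `s` of logarithm `typicalLog α`: `l = u`, `R = u² x`,
`τ = x^(-1/2)`. -/
lemma exists_integral_expansions {q : ℕ} (hq : p = 10 * q + 1) {R w : ℚ_[p]⟦X⟧} (hRw : R * w = 1)
    (hw : d⁄dX ℚ_[p] (d⁄dX ℚ_[p] (X ^ 2 * w)) = 2 - 12 * (X ^ 2 * w) ^ 5) :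
    ∃ (α : ℤ_[p]) (Z φ Z' : ℚ_[p]⟦X⟧), (p : ℤ_[p]) ∣ (hasseA p : ℤ_[p]) - α ∧
      Z ∈ integral p ∧ X ^ 2 * R.subst (typicalLog α) = Z * typicalLog α ^ 2 ∧
      Z' ∈ integral p ∧ X ^ 3 * φ.subst (typicalLog α) = Z' * typicalLog α ^ 3 ∧
      X * d⁄dX ℚ_[p] φ - 3 * φ = R ^ 2 := by
  obtain ⟨α, τ, hα, hτ0, hτ1, hτi, hτ⟩ := exists_parameter hq
  set l := typicalLog α with hl
  have hl0 : constantCoeff l = 0 := by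
    rw [← coeff_zero_eq_constantCoeff_apply, hl, coeff_zero_typicalLog]
  have hls := HasSubst.of_constantCoeff_zero' hl0
  have hτs := HasSubst.of_constantCoeff_zero' hτ0
  obtain ⟨g₀, h₀, hgh, hh, -⟩ := exists_dual α
  set g := PowerSeries.map (algebraMap ℤ_[p] ℚ_[p]) g₀
  have hgl : g * d⁄dX ℚ_[p] l = 1 := by rw [← hh, ← map_mul, hgh, map_one]
  have hDl : der g l = 1 := hgl
  have hg0 : constantCoeff g ≠ 0 := by
    intro h
    have := congrArg constantCoeff hgl
    rw [map_mul, h, zero_mul, map_one] at this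
    exact zero_ne_one this
  have hDsub : ∀ f : ℚ_[p]⟦X⟧, der g (f.subst l) = (d⁄dX ℚ_[p] f).subst l :=
    fun f => iterate_der_subst hl0 hgl 1 f
  -- the parameter `τ`
  have hDH : der g τ * (invSqrtSeries p).subst τ = 1 := by
    rw [der_apply, ← hgl, ← hτ, derivative_subst hτs, derivative_curveLog]
    ring
  have hsq : der g τ ^ 2 = 1 - τ ^ 10 := by
    have h := congrArg (PowerSeries.subst τ) (invSqrtSeries_sq hq)
    rw [subst_mul hτs, subst_pow hτs, subst_sub hτs, subst_pow hτs, subst_X hτs,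
      show (1 : ℚ_[p]⟦X⟧) = C 1 by simp, subst_C] at h
    change _ * (C 1 - τ ^ 10) = C 1 at h
    rw [map_one] at h
    linear_combination (-(der g τ) ^ 2) * h + (1 - τ ^ 10) *
      (der g τ * (invSqrtSeries p).subst τ + 1) * hDH
  have hDne : der g τ ≠ 0 := left_ne_zero_of_mul (hDH ▸ one_ne_zero)
  have hDD : der g (der g τ) = -5 * τ ^ 9 := by
    have h := congrArg (der g) hsq
    rw [Derivation.leibniz_pow, map_sub, Derivation.map_one_eq_zero, Derivation.leibniz_pow] at h
    simp only [smul_eq_mul, nsmul_eq_mul] at h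
    have : CharZero ℚ_[p]⟦X⟧ := charZero_of_injective_ringHom (C_injective (R := ℚ_[p]))
    apply mul_left_cancel₀ (mul_ne_zero two_ne_zero hDne)
    push_cast at h
    linear_combination h
  have hode : der g (der g (τ ^ 2)) = 2 - 12 * (τ ^ 2) ^ 5 := by
    have h : der g (τ ^ 2) = 2 * (τ * der g τ) := by
      rw [Derivation.leibniz_pow]
      simp only [smul_eq_mul, nsmul_eq_mul]
      push_cast
      ring
    rw [h, two_mul, map_add, Derivation.leibniz, smul_eq_mul, smul_eq_mul, hDD]
    linear_combination 2 * hsq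
  -- Both sides solve D² z = 2 - 12 z⁵ and vanish to order 2, which identifies τ² with 1/x.
  have hWτ : τ ^ 2 = l ^ 2 * w.subst l := by
    have e : (X ^ 2 * w).subst l = l ^ 2 * w.subst l := by
      rw [subst_mul hls, subst_pow hls, subst_X hls]
    rw [← e]
    refine ode_unique hg0 (pow_dvd_pow_of_dvd (X_dvd_iff.2 hτ0) 2)
      (e ▸ (pow_dvd_pow_of_dvd (X_dvd_iff.2 hl0) 2).mul_right _) hode ?_
    rw [hDsub, hDsub, hw, subst_sub hls, subst_mul hls, subst_pow hls]
    have hc : ∀ c : ℚ_[p], (C c : ℚ_[p]⟦X⟧).subst l = C c := fun c => subst_C c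
    rw [← map_ofNat C 2, ← map_ofNat C 12, hc, hc]
  have hRl : τ ^ 2 * R.subst l = l ^ 2 := by
    have h := congrArg (PowerSeries.subst l) hRw
    rw [subst_mul hls, show (1 : ℚ_[p]⟦X⟧) = C 1 by simp, subst_C] at h
    change _ = C 1 at h
    rw [map_one] at h
    linear_combination R.subst l * hWτ + l ^ 2 * h
  -- the quotient `s / τ`
  obtain ⟨κ, hκi, hκ⟩ : ∃ κ ∈ integral p, κ * τ = X := by
    obtain ⟨t, rfl⟩ := hτi
    have ht0 : constantCoeff t = 0 := by
      apply PadicInt.ext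
      rw [← coeff_zero_eq_constantCoeff_apply, coeff_map] at hτ0
      rw [← coeff_zero_eq_constantCoeff_apply]
      exact hτ0
    obtain ⟨t', rfl⟩ := X_dvd_iff.2 ht0
    have ht' : constantCoeff t' = 1 := by
      apply PadicInt.ext
      rw [coeff_map, show (1 : ℕ) = 0 + 1 by rfl, coeff_succ_X_mul,
        coeff_zero_eq_constantCoeff_apply] at hτ1
      exact hτ1
    obtain ⟨κ, hκ⟩ := isUnit_iff_exists_inv'.1 (isUnit_iff_constantCoeff.2 (ht' ▸ isUnit_one))
    refine ⟨_, ⟨κ, rfl⟩, ?_⟩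
    rw [← map_mul, show κ * (X * t') = X by linear_combination X * hκ, map_X]
  have hτne : τ ≠ 0 := by
    rintro rfl
    simp at hτ1
  -- the differential of the second kind
  set B := (secondKind p).subst τ with hB
  have hBi : B ∈ integral p := subst_mem_integral (secondKind_mem hq) hτi hτ0
  -- Equivalently D(τ^(-3) B) = τ^(-4) = x².
  have hDB : τ * der g B - 3 * B * der g τ = 1 := by
    have h := congrArg (PowerSeries.subst τ) (X_mul_derivative_secondKind (p := p))
    rw [subst_sub hτs, subst_mul hτs, subst_mul hτs, subst_X hτs, ← map_ofNat C 3, subst_C] at h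
    change _ - C 3 * _ = _ at h
    rw [map_ofNat] at h
    rw [hB, der_apply, derivative_subst hτs, ← hDH, ← h, der_apply]
    ring
  obtain ⟨l₁, hl₁⟩ := X_dvd_iff.2 hl0
  -- The right side is u³ τ^(-3) B written in s; inverting `l` re-expands it in u. Thus φ / u³ is an
  -- antiderivative of x².
  have hV : ∃ φ : ℚ_[p]⟦X⟧, φ.subst l = l₁ ^ 3 * (κ ^ 3 * B) := by
    have hu : IsUnit (coeff 1 l) := by rw [hl, coeff_one_typicalLog]; exact isUnit_one
    refine ⟨(l₁ ^ 3 * (κ ^ 3 * B)).subst (l.substInvOfIsUnit hu), ?_⟩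
    rw [subst_comp_subst_apply (HasSubst.substInvOfIsUnit l hu) hls,
      subst_substInvOfIsUnit_left l hl0 hu, X_subst]
  obtain ⟨φ, hφ⟩ := hV
  have hφ3 : X ^ 3 * φ.subst l = κ ^ 3 * B * l ^ 3 := by
    rw [hφ, hl₁]
    ring
  have hφτ : φ.subst l * τ ^ 3 = l ^ 3 * B := by
    rw [hφ, hl₁, ← hκ]
    ring
  refine ⟨α, κ ^ 2, φ, κ ^ 3 * B, hα, pow_mem hκi 2, ?_, mul_mem (pow_mem hκi 3) hBi, hφ3, ?_⟩
  · rw [← hκ]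
    linear_combination κ ^ 2 * hRl
  -- The identity says d(φ / u³)/du = R² / u^4. It is checked in s, where substitution of `l` is
  -- injective, after multiplying by τ^4.
  · have hinj : ∀ f f' : ℚ_[p]⟦X⟧, f.subst l = f'.subst l → f = f' := by
      intro f f' h
      have hu : IsUnit (coeff 1 l) := by rw [hl, coeff_one_typicalLog]; exact isUnit_one
      have hs := HasSubst.substInvOfIsUnit l hu
      have := congrArg (PowerSeries.subst (l.substInvOfIsUnit hu)) h
      rwa [subst_comp_subst_apply hls hs, subst_comp_subst_apply hls hs,
        subst_substInvOfIsUnit_right l hl0 hu, X_subst, X_subst] at this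
    apply hinj
    rw [subst_sub hls, subst_mul hls, subst_mul hls, subst_X hls, subst_pow hls, ← hDsub,
      ← map_ofNat C 3, subst_C]
    change _ - C 3 * _ = _
    rw [map_ofNat]
    have hD := congrArg (der g) hφτ
    simp only [Derivation.leibniz, Derivation.leibniz_pow, smul_eq_mul, nsmul_eq_mul, hDl] at hD
    push_cast at hD
    apply mul_left_cancel₀ (pow_ne_zero 4 hτne)
    linear_combination τ * l * hD - (τ ^ 2 * R.subst l + l ^ 2) * hRl + l ^ 4 * hDB -
      (3 * l * der g τ + 3 * τ) * hφτ

end Congruences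

end CurveExpansion

end

open CurveInversion in
theorem theorem2p8 (p : ℕ) (hp : p.Prime) (hp5 : p ≡ 1 [MOD 5]) (a n : ℕ) (ha : 0 < a)
    (hn : 0 < n) (han : a + 2 ≤ 10 * n) (hdvd : ¬ (p - 1) ∣ 10 * n) :
    CongrZero p a (∑ r ∈ Finset.range (a + 1),
      (-1 : ℚ) ^ r * (a.choose r : ℚ) * (hasseA p : ℚ) ^ (a - r) *
        (genC (10 * n + r * (p - 1)) / ((10 * n + r * (p - 1) : ℕ) : ℚ))) ∧
    (a + 3 ≤ 10 * n → CongrZero p a (∑ r ∈ Finset.range (a + 1),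
      (-1 : ℚ) ^ r * (a.choose r : ℚ) * (hasseA p : ℚ) ^ (a - r) *
        (genD (10 * n + r * (p - 1)) / ((10 * n + r * (p - 1) : ℕ) : ℚ)))) := by
  have : Fact p.Prime := ⟨hp⟩
  obtain ⟨q, hq⟩ : ∃ q, p = 10 * q + 1 := by
    have h1 : p % 5 = 1 := hp5
    have h2 : p % 2 = 1 := hp.eq_two_or_odd.resolve_left fun h => by omega
    exact ⟨p / 10, by omega⟩
  obtain ⟨R, w, hRw, hw, hx⟩ := CurveExpansion.exists_regular
  set f := PowerSeries.map (algebraMap ℚ ℚ_[p]) with hf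
  obtain ⟨α, Z, φ, Z', hα, hZ, hRZ, hZ', hφZ, hφ⟩ :=
    CurveExpansion.exists_integral_expansions hq (R := f R) (w := f w)
      (by rw [← map_mul, hRw, map_one]) (by
        have := congrArg f hw
        rw [hf, ← CurveExpansion.derivative_map, ← CurveExpansion.derivative_map, ← hf,
          map_mul f, map_pow f] at this
        have h2 : f 2 = 2 := map_ofNat f 2
        have h12 : f 12 = 12 := map_ofNat f 12
        have hr : f (2 - 12 * (PowerSeries.X ^ 2 * w) ^ 5) =
            2 - 12 * (PowerSeries.X ^ 2 * f w) ^ 5 := by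
          rw [map_sub, map_mul, map_pow, map_mul, map_pow, h2, h12, hf, PowerSeries.map_X]
        rw [hr] at this
        rwa [hf, PowerSeries.map_X] at this)
  -- As 10 ∣ p - 1, a polar index j ≡ 10n mod p - 1 is a multiple of 10 below 10, hence 0, and then
  -- p - 1 would divide 10n.
  have hmod : ∀ e ≤ 10, ∀ N, N + e = 10 * n → ∀ j < e, ¬ j ≡ N + e [MOD p - 1] := by
    intro e he N hN j hj h
    rw [hN] at h
    have h10 : j ≡ 10 * n [MOD 10] := h.of_dvd ⟨q, by omega⟩
    have hj0 : j = 0 := by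
      have : j % 10 = 10 * n % 10 := h10
      omega
    subst hj0
    exact hdvd ((Nat.modEq_zero_iff_dvd).1 h.symm)
  refine ⟨?_, fun han' => ?_⟩
  · have hle : a ≤ 10 * n - 2 := by omega
    have hN := hmod 2 (by norm_num) (10 * n - 2) (by omega)
    obtain ⟨z, hz⟩ := CurveExpansion.kummer_congruence hα hle hZ hRZ hN
    apply CurveExpansion.congrZero_of_eq (z := z)
    rw [← hz]
    push_cast
    refine Finset.sum_congr rfl fun r _ => ?_
    have h := CurveExpansion.genC_div hx (m := 10 * n + r * (p - 1)) (by omega)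
    rw [show 10 * n - 2 + r * (p - 1) + 2 = 10 * n + r * (p - 1) by omega,
      show 10 * n - 2 + r * (p - 1) = 10 * n + r * (p - 1) - 2 by omega, hf,
      PowerSeries.coeff_map]
    have h' := congrArg (Rat.cast : ℚ → ℚ_[p]) h
    push_cast at h'
    rw [h']
    simp
  · have hle : a ≤ 10 * n - 3 := by omega
    have hN := hmod 3 (by norm_num) (10 * n - 3) (by omega)
    obtain ⟨z, hz⟩ := CurveExpansion.kummer_congruence hα hle hZ' hφZ hN
    -- The factor 1/4 comes from 4y = d(x²)/du.
    apply CurveExpansion.congrZero_of_eq (z := Ring.inverse 4 * z)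
    have h4 : (4 : ℚ_[p]) * ((Ring.inverse 4 : ℤ_[p]) : ℚ_[p]) = 1 := by
      have := congrArg (fun x : ℤ_[p] => (x : ℚ_[p])) (CurveExpansion.four_mul_inverse hq)
      have e4 : ((4 : ℤ_[p]) : ℚ_[p]) = 4 := CurveExpansion.coe_ofNat 4
      push_cast at this
      rwa [e4] at this
    rw [PadicInt.coe_mul, mul_left_comm, ← hz, Finset.mul_sum]
    push_cast
    refine Finset.sum_congr rfl fun r _ => ?_
    have h := CurveExpansion.genD_div hx (m := 10 * n + r * (p - 1)) (by omega)
    have h' := congrArg (Rat.cast : ℚ → ℚ_[p]) h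
    push_cast at h'
    -- At exponent m the relation u φ' - 3φ = R² multiplies the coefficient of φ by m - 3, which
    -- turns (m-4)! into (m-3)!.
    have hc : (((10 * n + r * (p - 1) - 4).factorial : ℕ) : ℚ_[p]) *
        ((PowerSeries.coeff (10 * n + r * (p - 1)) (R ^ 2) : ℚ) : ℚ_[p]) =
        ((10 * n + r * (p - 1) - 3).factorial : ℕ) *
          PowerSeries.coeff (10 * n + r * (p - 1)) φ := by
      obtain ⟨j, hj⟩ : ∃ j, 10 * n + r * (p - 1) = j + 4 := ⟨10 * n + r * (p - 1) - 4, by omega⟩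
      have hc := congrArg (PowerSeries.coeff (j + 4)) hφ
      rw [map_sub, PowerSeries.coeff_succ_X_mul, PowerSeries.coeff_derivative, ← map_pow, hf,
        PowerSeries.coeff_map, ← map_ofNat PowerSeries.C 3, PowerSeries.coeff_C_mul,
        eq_ratCast] at hc
      rw [hj, ← hc, show j + 4 - 4 = j by omega, show j + 4 - 3 = j + 1 by omega,
        Nat.factorial_succ]
      push_cast
      ring
    rw [show 10 * n - 3 + r * (p - 1) + 3 = 10 * n + r * (p - 1) by omega,
      show 10 * n - 3 + r * (p - 1) = 10 * n + r * (p - 1) - 3 by omega, h', hc]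
    generalize ((Ring.inverse 4 : ℤ_[p]) : ℚ_[p]) = i at h4
    have hi : i = 1 / 4 := by
      rw [eq_div_iff (by norm_num)]
      linear_combination h4
    rw [hi]
    ring
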